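/- Fix an integer $\ell\ge 5$. All graphs are finite and simple, and the length of a path or cycle is its number of edges. A hole of $G$ is an induced subgraph that is a cycle of length at least four; a path or hole is long if its length is at least $\ell$; a shortest long odd hole of $G$ is a hole of minimum length among the holes of $G$ of odd length at least $\ell$. For a hole $C$, a vertex $x\in V(G)\setminus V(C)$ is $C$-major if no three-vertex path of $C$ contains all the neighbours of $x$ in $V(C)$; and $C$ is clean if no vertex is $C$-major. The interior of a path is the set of its vertices that are not its ends. A long jewel of $G$ is formed by three induced paths $Q_1,Q_2,P$ of $G$ with the same two ends, where $Q_1,Q_2$ have lengths of different parity, $P$ has length at least $\ell$, and no interior vertex of $P$ equals or is adjacent to an interior vertex of $Q_1$ or $Q_2$; its order is $\max(|V(Q_1)|,|V(Q_2)|)$. A long pyramid of $G$ is formed by three induced paths $P_1,P_2,P_3$ of $G$, where $P_i$ has ends $v_0$ and $v_i\neq v_0$, such that the $P_i$ are pairwise vertex-disjoint except for $v_0$, at least two of them have length at least $\ell$, the vertices $v_1,v_2,v_3$ are pairwise adjacent, and for $i<j$ the only edge of $G$ between $V(P_i)\setminus\{v_0\}$ and $V(P_j)\setminus\{v_0\}$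 is $v_iv_j$. Theorem. Let $G$ be a graph containing no long jewel of order at most $\ell+2$, no long pyramid, and no long odd hole of length at most $2\ell+2$. Let $C$ be a clean shortest long odd hole in $G$. Let $u,v\in V(C)$ be distinct and nonadjacent, and let $L_1,L_2$ be the two subpaths of $C$ joining $u,v$, where $|E(L_1)|<|E(L_2)|$. Then: - $L_1$ is a shortest path in $G$ between $u$ and $v$; and - for every shortest path $P$ in $G$ between $u$ and $v$, $P\cup L_2$ is a clean shortest long odd hole in $G$. -/

import Mathlib

/-! Holes, major vertices, long jewels and long pyramids in a simple graph.  Paths are walks that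
satisfy `IsPath`; subgraphs "of `G`" are elements of `G.Subgraph`; "long" means length at least `ℓ`,
where length counts edges. -/

namespace LongHole

variable {V : Type*} {G : SimpleGraph V}

/-- `C` is a hole of length `n`: an induced subgraph which is a cycle with `n ≥ 4` edges. -/
def IsHole (C : G.Subgraph) (n : ℕ) : Prop :=
  C.IsInduced ∧ 4 ≤ n ∧ ∃ (a : V) (c : G.Walk a a), c.IsCycle ∧ c.length = n ∧ c.toSubgraph = C

/-- `C` is a long odd hole, of length `n`. -/
def IsLongOddHole (ℓ : ℕ) (C : G.Subgraph) (n : ℕ) : Prop :=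
  IsHole C n ∧ ℓ ≤ n ∧ Odd n

/-- `C` is a long odd hole of `G` of minimum length. -/
def IsShortestLongOddHole (ℓ : ℕ) (C : G.Subgraph) : Prop :=
  ∃ n : ℕ, IsLongOddHole ℓ C n ∧ ∀ (C' : G.Subgraph) (m : ℕ), IsLongOddHole ℓ C' m → n ≤ m

/-- The vertex `x ∉ V(C)` is `C`-major: no three-vertex path `a - b - c` of `C` contains all the
neighbours of `x` in `V(C)`. -/
def IsMajor (C : G.Subgraph) (x : V) : Prop :=
  x ∉ C.verts ∧
    ¬ ∃ a b c : V, C.Adj a b ∧ C.Adj b c ∧ a ≠ c ∧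
      ∀ y ∈ C.verts, G.Adj x y → y = a ∨ y = b ∨ y = c

/-- `C` is clean: no vertex is `C`-major. -/
def IsClean (C : G.Subgraph) : Prop :=
  ∀ x : V, ¬ IsMajor C x

/-- The walk `P` is an induced path of `G`. -/
def IsInducedPath {u v : V} (P : G.Walk u v) : Prop :=
  P.IsPath ∧ P.toSubgraph.IsInduced

/-- The walk `P` is a shortest path of `G` between its ends. -/
def IsShortestPath {u v : V} (P : G.Walk u v) : Prop :=
  P.IsPath ∧ ∀ P' : G.Walk u v, P'.IsPath → P.length ≤ P'.length

/-- The interior of a path: its vertices that are not ends. -/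
def interior {u v : V} (P : G.Walk u v) : Set V :=
  {x | x ∈ P.support ∧ x ≠ u ∧ x ≠ v}

/-- The paths `Q₁, Q₂, P` form a long jewel. -/
structure FormLongJewel (ℓ : ℕ) {u v : V} (Q₁ Q₂ P : G.Walk u v) : Prop where
  induced_left : IsInducedPath Q₁
  induced_right : IsInducedPath Q₂
  parity : ¬ (Even Q₁.length ↔ Even Q₂.length)
  induced_long : IsInducedPath P
  long : ℓ ≤ P.length
  anticomplete : ∀ x ∈ interior P, ∀ y ∈ interior Q₁ ∪ interior Q₂, x ≠ y ∧ ¬ G.Adj x y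

/-- `G` contains a long jewel of order at most `k`, where the order of the jewel formed by
`Q₁, Q₂, P` is `max(|V(Q₁)|, |V(Q₂)|)`. -/
def HasLongJewel (G : SimpleGraph V) (ℓ k : ℕ) : Prop :=
  ∃ (u v : V) (Q₁ Q₂ P : G.Walk u v),
    FormLongJewel ℓ Q₁ Q₂ P ∧ max Q₁.support.length Q₂.support.length ≤ k

/-- The paths `P 0, P 1, P 2`, from the apex `a` to the base vertices `b 0, b 1, b 2`, form a
long pyramid. -/
structure FormLongPyramid (ℓ : ℕ) {a : V} {b : Fin 3 → V} (P : ∀ i, G.Walk a (b i)) : Prop where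
  induced : ∀ i, IsInducedPath (P i)
  disjoint : ∀ i j, i ≠ j → ∀ x, x ∈ (P i).support → x ∈ (P j).support → x = a
  base_ne_apex : ∀ i, b i ≠ a
  two_long : ∃ i j, i ≠ j ∧ ℓ ≤ (P i).length ∧ ℓ ≤ (P j).length
  base_adj : ∀ i j, i ≠ j → G.Adj (b i) (b j)
  only_edge : ∀ i j, i ≠ j → ∀ x ∈ (P i).support, ∀ y ∈ (P j).support,
    x ≠ a → y ≠ a → G.Adj x y → x = b i ∧ y = b j

/-- `G` contains a long pyramid. -/
def HasLongPyramid (G : SimpleGraph V) (ℓ : ℕ) : Prop :=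
  ∃ (a : V) (b : Fin 3 → V) (P : ∀ i, G.Walk a (b i)), FormLongPyramid ℓ P

end LongHole

namespace LongHole

open SimpleGraph

section

/-! ### Cyclic sequences of vertices, walks and splicing -/

variable {V : Type*} {G : SimpleGraph V}

/-! Let `n` be the minimum length of a long odd hole. Two statements about all clean holes of length
`n` are proved together by induction on `K`: `DistBound` (a walk of length at most `K` never beats
the hole) and `Rerouting` (an arc of length at most `K`, shorter than its complement, may be
replaced by any walk of the same length, and the new hole is again clean). Quantifying over every
clean hole of length `n` is essential: after one rerouting, the induction hypothesis is applied to
the new hole. The theorem is the case where the arc is `L₁`.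

The hypotheses on `G` enter mainly through `Setting.not_ear`: a path off the hole, each of whose
ends attaches at one vertex or at two consecutive ones, is not a shortcut. If both ends attach in
the same way, exactly one of the two cycles through the ear is odd. It is shorter than `n`, hence
shorter than `ℓ`, and then the ear, the short arc and the long arc form a jewel of small order. If
one end attaches at a vertex and the other at an edge, a short arc again gives a jewel or a shorter
hole, while two long arcs give a pyramid.

For `DistBound`, take a shortest walk beating both arcs (`Bad`). Any attachment in its middle, or a
spread-out attachment at an end, would let part of the hole be rerouted so that smaller `K` gives a
contradiction; what remains is an ear. For `Rerouting`, take a shortest walk as long as the arc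
(`Tight`). The same ideas, with the parity of `n`, show that its interior sends no edge to the
complementary arc, so the new cycle is a hole. A major vertex of the new hole would have neighbours
inside the walk and inside the complementary arc; replacing single vertices by it makes each set of
neighbours at most an edge, and the vertex is then an ear of length two. -/

/-- `f 0, …, f (n-1)` are the vertices of a hole of `G`, in cyclic order. -/
structure IsHoleMap (G : SimpleGraph V) (n : ℕ) (f : ℕ → V) : Prop where
  four_le : 4 ≤ n
  inj : ∀ i j, i < n → j < n → f i = f j → i = j
  adj : ∀ i j, i < n → j < n →
    (G.Adj (f i) (f j) ↔ i + 1 = j ∨ j + 1 = i ∨ (i = 0 ∧ j + 1 = n) ∨ (j = 0 ∧ i + 1 = n))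

/-- `p 0, …, p k` are the vertices of an induced path of `G`, in order. -/
structure IsIndPath (G : SimpleGraph V) (k : ℕ) (p : ℕ → V) : Prop where
  inj : ∀ i j, i ≤ k → j ≤ k → p i = p j → i = j
  adj : ∀ i j, i ≤ k → j ≤ k → (G.Adj (p i) (p j) ↔ i + 1 = j ∨ j + 1 = i)

/-- The neighbours on the cycle `f` of each vertex off the cycle lie in a closed neighbourhood
of a vertex of the cycle. -/
def CleanMap (G : SimpleGraph V) (n : ℕ) (f : ℕ → V) : Prop :=
  ∀ x, (∀ j < n, x ≠ f j) → ∃ c < n, ∀ j < n, G.Adj x (f j) →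
    j = c ∨ c + 1 = j ∨ j + 1 = c ∨ (c = 0 ∧ j + 1 = n) ∨ (j = 0 ∧ c + 1 = n)

/-- Shift of a cyclic sequence of length `n`. -/
def rotate (n c : ℕ) (f : ℕ → V) : ℕ → V := fun i => if i + c < n then f (i + c) else f (i + c - n)

/-- Reversal of a cyclic sequence of length `n`. -/
def reflect (n c : ℕ) (f : ℕ → V) : ℕ → V := fun i => if i ≤ c then f (c - i) else f (n + c - i)

theorem rotate_eq {n c i j : ℕ} (f : ℕ → V) (hj : j < n) (h : i + c = j ∨ i + c = j + n) :
    rotate n c f i = f j := by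
  unfold rotate; split_ifs <;> congr 1 <;> omega

theorem reflect_eq {n c i j : ℕ} (f : ℕ → V) (hi : i < n) (hj : j < n)
    (h : i + j = c ∨ i + j = c + n) : reflect n c f i = f j := by
  unfold reflect; split_ifs <;> congr 1 <;> omega

theorem exists_rotate_index {n c : ℕ} (hc : c < n) (i : ℕ) (hi : i < n) :
    ∃ j < n, i + c = j ∨ i + c = j + n := by
  by_cases h : i + c < n
  · exact ⟨_, h, .inl rfl⟩
  · exact ⟨i + c - n, by omega, by omega⟩

theorem exists_unrotate_index {n c : ℕ} (hc : c < n) (j : ℕ) (hj : j < n) :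
    ∃ i < n, i + c = j ∨ i + c = j + n := by
  by_cases h : c ≤ j
  · exact ⟨j - c, by omega, by omega⟩
  · exact ⟨j + n - c, by omega, by omega⟩

theorem exists_reflect_index {n c : ℕ} (hc : c < n) (i : ℕ) (hi : i < n) :
    ∃ j < n, i + j = c ∨ i + j = c + n := by
  by_cases h : i ≤ c
  · exact ⟨c - i, by omega, by omega⟩
  · exact ⟨n + c - i, by omega, by omega⟩

theorem IsHoleMap.rotate {n c : ℕ} {f : ℕ → V} (hf : IsHoleMap G n f) (hc : c < n) :
    IsHoleMap G n (rotate n c f) := by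
  have h4 := hf.four_le
  refine ⟨h4, fun i j hi hj h => ?_, fun i j hi hj => ?_⟩ <;>
    obtain ⟨i', hi', hii⟩ := exists_rotate_index hc i hi <;>
    obtain ⟨j', hj', hjj⟩ := exists_rotate_index hc j hj
  · rw [rotate_eq f hi' hii, rotate_eq f hj' hjj] at h
    have := hf.inj _ _ hi' hj' h
    omega
  · rw [rotate_eq f hi' hii, rotate_eq f hj' hjj, hf.adj _ _ hi' hj']
    omega

theorem IsHoleMap.reflect {n c : ℕ} {f : ℕ → V} (hf : IsHoleMap G n f) (hc : c < n) :
    IsHoleMap G n (reflect n c f) := by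
  have h4 := hf.four_le
  refine ⟨h4, fun i j hi hj h => ?_, fun i j hi hj => ?_⟩ <;>
    obtain ⟨i', hi', hii⟩ := exists_reflect_index hc i hi <;>
    obtain ⟨j', hj', hjj⟩ := exists_reflect_index hc j hj
  · rw [reflect_eq f hi hi' hii, reflect_eq f hj hj' hjj] at h
    have := hf.inj _ _ hi' hj' h
    omega
  · rw [reflect_eq f hi hi' hii, reflect_eq f hj hj' hjj, hf.adj _ _ hi' hj']
    omega

theorem CleanMap.rotate {n c : ℕ} {f : ℕ → V} (hf : CleanMap G n f) (h4 : 4 ≤ n) (hc : c < n) :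
    CleanMap G n (rotate n c f) := by
  intro x hx
  obtain ⟨a, ha, h⟩ := hf x fun j hj => by
    obtain ⟨i, hi, hij⟩ := exists_unrotate_index hc j hj
    rw [← rotate_eq f hj hij]; exact hx i hi
  obtain ⟨a', ha', haa⟩ := exists_unrotate_index hc a ha
  refine ⟨a', ha', fun j hj hadj => ?_⟩
  obtain ⟨j', hj', hjj⟩ := exists_rotate_index hc j hj
  rw [rotate_eq f hj' hjj] at hadj
  have := h j' hj' hadj
  omega

theorem CleanMap.reflect {n c : ℕ} {f : ℕ → V} (hf : CleanMap G n f) (h4 : 4 ≤ n) (hc : c < n) :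
    CleanMap G n (reflect n c f) := by
  intro x hx
  obtain ⟨a, ha, h⟩ := hf x fun j hj => by
    obtain ⟨i, hi, hij⟩ := exists_reflect_index hc j hj
    rw [← reflect_eq (c := c) f hi hj (by omega)]; exact hx i hi
  obtain ⟨a', ha', haa⟩ := exists_reflect_index hc a ha
  refine ⟨a', ha', fun j hj hadj => ?_⟩
  obtain ⟨j', hj', hjj⟩ := exists_reflect_index hc j hj
  rw [reflect_eq f hj hj' hjj] at hadj
  have := h j' hj' hadj
  omega

/-! ### Walk distance and geodesics. -/

/-- There is a walk of length at most `k` from `a` to `b`. -/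
def Within (G : SimpleGraph V) (k : ℕ) (a b : V) : Prop := ∃ w : G.Walk a b, w.length ≤ k

theorem Within.symm {k : ℕ} {a b : V} (h : Within G k a b) : Within G k b a := by
  obtain ⟨w, hw⟩ := h
  exact ⟨w.reverse, by simpa using hw⟩

theorem Within.trans {k m : ℕ} {a b c : V} (h : Within G k a b) (h' : Within G m b c) :
    Within G (k + m) a c := by
  obtain ⟨w, hw⟩ := h
  obtain ⟨w', hw'⟩ := h'
  exact ⟨w.append w', by rw [Walk.length_append]; omega⟩

theorem Within.of_adj {a b : V} (h : G.Adj a b) : Within G 1 a b := ⟨h.toWalk, by simp⟩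

theorem Within.of_eq {a b : V} (h : a = b) : Within G 0 a b := by
  subst h; exact ⟨.nil, by simp⟩

/-- `p 0, …, p k` is a walk of `G`. -/
def IsWalkMap (G : SimpleGraph V) (k : ℕ) (p : ℕ → V) : Prop := ∀ i < k, G.Adj (p i) (p (i + 1))

theorem IsWalkMap.exists_walk {k : ℕ} {p : ℕ → V} (hp : IsWalkMap G k p) :
    ∃ w : G.Walk (p 0) (p k), w.length = k ∧ ∀ i ≤ k, w.getVert i = p i := by
  induction k generalizing p with
  | zero => exact ⟨.nil, rfl, fun i hi => by simp [Nat.le_zero.1 hi]⟩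
  | succ k ih =>
    obtain ⟨w, hw, h⟩ := ih (p := fun i => p (i + 1)) fun i hi => hp (i + 1) (by omega)
    refine ⟨.cons (hp 0 (by omega)) w, by simp [hw], fun i hi => ?_⟩
    cases i with
    | zero => simp
    | succ i => rw [Walk.getVert_cons_succ]; exact h i (by omega)

theorem IsWalkMap.within {k : ℕ} {p : ℕ → V} (hp : IsWalkMap G k p) {i j : ℕ} (hij : i ≤ j)
    (hj : j ≤ k) : Within G (j - i) (p i) (p j) := by
  obtain ⟨m, rfl⟩ := Nat.exists_eq_add_of_le hij
  obtain ⟨w, hw, -⟩ := IsWalkMap.exists_walk (G := G) (k := m) (p := fun t => p (i + t))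
    fun t ht => hp (i + t) (by omega)
  exact ⟨w, by omega⟩

theorem IsIndPath.isWalkMap {k : ℕ} {p : ℕ → V} (hp : IsIndPath G k p) : IsWalkMap G k p :=
  fun i hi => (hp.adj i (i + 1) (by omega) (by omega)).2 (.inl rfl)

/-- A walk without shortcuts. -/
def IsGeodesic (G : SimpleGraph V) (k : ℕ) (p : ℕ → V) : Prop :=
  IsWalkMap G k p ∧ ∀ m, Within G m (p 0) (p k) → k ≤ m

theorem IsGeodesic.le_of_within {k : ℕ} {p : ℕ → V} (hp : IsGeodesic G k p) {i j m : ℕ}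
    (hi : i ≤ k) (hj : j ≤ k) (h : Within G m (p i) (p j)) : j ≤ i + m ∧ i ≤ j + m := by
  have h1 := hp.2 _ (((hp.1.within (Nat.zero_le i) hi).trans h).trans (hp.1.within hj le_rfl))
  have h2 := hp.2 _ (((hp.1.within (Nat.zero_le j) hj).trans h.symm).trans (hp.1.within hi le_rfl))
  omega

theorem IsGeodesic.isIndPath {k : ℕ} {p : ℕ → V} (hp : IsGeodesic G k p) : IsIndPath G k p := by
  refine ⟨fun i j hi hj h => ?_, fun i j hi hj => ⟨fun h => ?_, fun h => ?_⟩⟩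
  · have := hp.le_of_within hi hj (.of_eq h); omega
  · have := hp.le_of_within hi hj (.of_adj h)
    have : i ≠ j := by rintro rfl; exact h.ne rfl
    omega
  · rcases h with rfl | rfl
    · exact hp.1 _ (by omega)
    · exact (hp.1 _ (by omega)).symm

/-! ### Splicing a path into a hole. -/

/-- The cyclic sequence obtained from `f` by replacing `f 0, …, f d` by `p 0, …, p k`. -/
def splice (d : ℕ) (f : ℕ → V) (k : ℕ) (p : ℕ → V) : ℕ → V :=
  fun i => if i ≤ k then p i else f (i - k + d)

theorem splice_of_le {d k i : ℕ} {f p : ℕ → V} (h : i ≤ k) : splice d f k p i = p i := if_pos h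

theorem splice_of_lt {d k i j : ℕ} {f p : ℕ → V} (h : k < i) (hj : i + d = j + k) :
    splice d f k p i = f j := by
  unfold splice; rw [if_neg (by omega)]; congr 1; omega

theorem IsHoleMap.splice {n d k : ℕ} {f p : ℕ → V} (hf : IsHoleMap G n f) (hp : IsIndPath G k p)
    (h0 : p 0 = f 0) (hk : p k = f d) (hd : 1 ≤ d) (hdn : d + 1 < n) (h4 : 4 ≤ n - d + k)
    (hanti : ∀ i j, 0 < i → i < k → d < j → j < n → p i ≠ f j ∧ ¬ G.Adj (p i) (f j)) :
    IsHoleMap G (n - d + k) (splice d f k p) := by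
  have key : ∀ i j, i ≤ k → d < j → j < n →
      p i ≠ f j ∧ (G.Adj (p i) (f j) ↔ (i = 0 ∧ j + 1 = n) ∨ (i = k ∧ j = d + 1)) := by
    intro i j hi hdj hj
    by_cases hi0 : i = 0
    · subst hi0
      rw [h0]
      refine ⟨fun h => ?_, ?_⟩
      · have := hf.inj _ _ (by omega) hj h; omega
      · rw [hf.adj _ _ (by omega) hj]
        -- A path of length zero would identify `f 0` with `f d`.
        by_cases hk0 : k = 0
        · subst hk0
          have := hf.inj 0 d (by omega) (by omega) (h0.symm.trans hk)
          omega
        · omega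
    by_cases hik : i = k
    · subst hik
      rw [hk]
      refine ⟨fun h => ?_, ?_⟩
      · have := hf.inj _ _ (by omega) hj h; omega
      · rw [hf.adj _ _ (by omega) hj]; omega
    · have := hanti i j (by omega) (by omega) hdj hj
      exact ⟨this.1, iff_of_false this.2 (by omega)⟩
  refine ⟨h4, fun i j hi hj h => ?_, fun i j hi hj => ?_⟩
  · rcases le_or_gt i k with hik | hik <;> rcases le_or_gt j k with hjk | hjk
    · rw [splice_of_le hik, splice_of_le hjk] at h
      exact hp.inj _ _ hik hjk h
    · rw [splice_of_le hik, splice_of_lt (j := j - k + d) hjk (by omega)] at h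
      exact absurd h (key i _ hik (by omega) (by omega)).1
    · rw [splice_of_lt (j := i - k + d) hik (by omega), splice_of_le hjk] at h
      exact absurd h.symm (key j _ hjk (by omega) (by omega)).1
    · rw [splice_of_lt (j := i - k + d) hik (by omega),
        splice_of_lt (j := j - k + d) hjk (by omega)] at h
      have := hf.inj _ _ (by omega) (by omega) h
      omega
  · rcases le_or_gt i k with hik | hik <;> rcases le_or_gt j k with hjk | hjk
    · rw [splice_of_le hik, splice_of_le hjk, hp.adj _ _ hik hjk]
      omega
    · rw [splice_of_le hik, splice_of_lt (j := j - k + d) hjk (by omega),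
        (key i _ hik (by omega) (by omega)).2]
      omega
    · rw [splice_of_lt (j := i - k + d) hik (by omega), splice_of_le hjk, G.adj_comm,
        (key j _ hjk (by omega) (by omega)).2]
      omega
    · rw [splice_of_lt (j := i - k + d) hik (by omega),
        splice_of_lt (j := j - k + d) hjk (by omega), hf.adj _ _ (by omega) (by omega)]
      omega

end

section

/-! ### Ears of a shortest long odd hole -/

variable {V : Type*} {G : SimpleGraph V}

/-- `G` has no long pyramid and no long jewel of order at most `ℓ + 2`, and `n ≥ 2 * ℓ + 3` is odd
and a lower bound for the lengths of the long odd holes. -/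
structure Setting (G : SimpleGraph V) (ℓ n : ℕ) : Prop where
  five_le : 5 ≤ ℓ
  large : 2 * ℓ + 3 ≤ n
  odd : n % 2 = 1
  min : ∀ m f, IsHoleMap G m f → m % 2 = 1 → ℓ ≤ m → n ≤ m
  no_jewel : ∀ (k₁ k₂ k : ℕ) (q₁ q₂ q : ℕ → V), IsIndPath G k₁ q₁ → IsIndPath G k₂ q₂ →
    IsIndPath G k q → q₁ 0 = q 0 → q₂ 0 = q 0 → q₁ k₁ = q k → q₂ k₂ = q k →
    (k₁ + k₂) % 2 = 1 → ℓ ≤ k → k₁ ≤ ℓ + 1 → k₂ ≤ ℓ + 1 →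
    (∀ i j, 0 < i → i < k → 0 < j → j < k₁ → q i ≠ q₁ j ∧ ¬ G.Adj (q i) (q₁ j)) →
    (∀ i j, 0 < i → i < k → 0 < j → j < k₂ → q i ≠ q₂ j ∧ ¬ G.Adj (q i) (q₂ j)) → False
  no_pyramid : ∀ (k₀ k₁ k₂ : ℕ) (p₀ p₁ p₂ : ℕ → V), IsIndPath G k₀ p₀ → IsIndPath G k₁ p₁ →
    IsIndPath G k₂ p₂ → p₁ 0 = p₀ 0 → p₂ 0 = p₀ 0 → ℓ ≤ k₀ → ℓ ≤ k₁ → 1 ≤ k₂ →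
    (∀ i j, 0 < i → i ≤ k₀ → 0 < j → j ≤ k₁ →
      p₀ i ≠ p₁ j ∧ (G.Adj (p₀ i) (p₁ j) ↔ i = k₀ ∧ j = k₁)) →
    (∀ i j, 0 < i → i ≤ k₀ → 0 < j → j ≤ k₂ →
      p₀ i ≠ p₂ j ∧ (G.Adj (p₀ i) (p₂ j) ↔ i = k₀ ∧ j = k₂)) →
    (∀ i j, 0 < i → i ≤ k₁ → 0 < j → j ≤ k₂ →
      p₁ i ≠ p₂ j ∧ (G.Adj (p₁ i) (p₂ j) ↔ i = k₁ ∧ j = k₂)) → False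

/-- The path `p 1, …, p (k-1)` is disjoint from the hole `f`; its only neighbours on the hole are
neighbours of `p 1` in `f 0, …, f g`, including the two ends of this arc, and neighbours of
`p (k-1)` in `f (e-h), …, f e`, including the two ends. -/
structure Ear (G : SimpleGraph V) (n : ℕ) (f p : ℕ → V) (k g h e : ℕ) : Prop where
  hole : IsHoleMap G n f
  two_le : 2 ≤ k
  inj : ∀ i j, 0 < i → i < k → 0 < j → j < k → p i = p j → i = j
  adj : ∀ i j, 0 < i → i < k → 0 < j → j < k → (G.Adj (p i) (p j) ↔ i + 1 = j ∨ j + 1 = i)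
  off : ∀ i j, 0 < i → i < k → j < n → p i ≠ f j
  nbr : ∀ i j, 0 < i → i < k → j < n → G.Adj (p i) (f j) →
    (i = 1 ∧ j ≤ g) ∨ (i + 1 = k ∧ e ≤ j + h ∧ j ≤ e)
  adj_zero : G.Adj (p 1) (f 0)
  adj_left : G.Adj (p 1) (f g)
  adj_end : G.Adj (p (k - 1)) (f e)
  adj_right : G.Adj (p (k - 1)) (f (e - h))
  le : g + h ≤ e
  lt : e < n

variable {ℓ n k g h e : ℕ} {f p : ℕ → V}

theorem IsHoleMap.arc (hf : IsHoleMap G n f) {s : ℕ} (hs : s + 2 ≤ n) : IsIndPath G s f := by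
  refine ⟨fun i j hi hj => hf.inj i j (by omega) (by omega), fun i j hi hj => ?_⟩
  rw [hf.adj i j (by omega) (by omega)]; omega

/-- Reading the hole backwards from `f g` exchanges the two cycles through the ear: the one avoiding
both attachment arcs on one side, of length `n - e + k`, and the one on the other side, of length `e
- g - h + k`. -/
theorem Ear.reflect (H : Ear G n f p k g h e) (hlt : g + h < e) :
    Ear G n (reflect n g f) p k g h (n - e + g + h) := by
  have hen := H.lt
  have hg : g < n := by omega
  refine ⟨H.hole.reflect hg, H.two_le, H.inj, H.adj, fun i j hi hik hj => ?_,
    fun i j hi hik hj => ?_, ?_, ?_, ?_, ?_, by omega, by omega⟩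
  · obtain ⟨j', hj', hjj⟩ := exists_reflect_index hg j hj
    rw [reflect_eq f hj hj' hjj]; exact H.off i j' hi hik hj'
  · obtain ⟨j', hj', hjj⟩ := exists_reflect_index hg j hj
    rw [reflect_eq f hj hj' hjj]
    intro hadj
    have := H.nbr i j' hi hik hj' hadj
    omega
  · rw [reflect_eq (j := g) f (by omega) hg (by omega)]; exact H.adj_left
  · rw [reflect_eq (j := 0) f hg (by omega) (by omega)]; exact H.adj_zero
  · rw [reflect_eq (j := e - h) f (by omega) (by omega) (by omega)]; exact H.adj_right
  · rw [reflect_eq (j := e) f (by omega) (by omega) (by omega)]; exact H.adj_end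

theorem Ear.swap (H : Ear G n f p k g h e) :
    Ear G n (LongHole.reflect n e f) (fun i => p (k - i)) k h g e := by
  have hen := H.lt
  have hk := H.two_le
  have hle := H.le
  refine ⟨H.hole.reflect hen, hk, fun i j hi hik hj hjk hij => ?_, fun i j hi hik hj hjk => ?_,
    fun i j hi hik hj => ?_, fun i j hi hik hj => ?_, ?_, ?_, ?_, ?_, by omega, by omega⟩
  · have := H.inj _ _ (by omega) (by omega) (by omega) (by omega) hij; omega
  · rw [H.adj _ _ (by omega) (by omega) (by omega) (by omega)]; omega
  · obtain ⟨j', hj', hjj⟩ := exists_reflect_index hen j hj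
    rw [reflect_eq f hj hj' hjj]; exact H.off _ j' (by omega) (by omega) hj'
  · obtain ⟨j', hj', hjj⟩ := exists_reflect_index hen j hj
    rw [reflect_eq f hj hj' hjj]
    intro hadj
    have := H.nbr _ j' (by omega) (by omega) hj' hadj
    omega
  · rw [reflect_eq (j := e) f (by omega) hen (by omega)]; exact H.adj_end
  · rw [reflect_eq (j := e - h) f (by omega) (by omega) (by omega)]; exact H.adj_right
  · rw [reflect_eq (j := 0) f hen (by omega) (by omega)]
    simpa [show k - (k - 1) = 1 by omega] using H.adj_zero
  · rw [reflect_eq (j := g) f (by omega) (by omega) (by omega)]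
    simpa [show k - (k - 1) = 1 by omega] using H.adj_left

/-- The sequence `p 0, …, p k` with its ends changed to `x` and `y`. -/
def withEnds (x y : V) (k : ℕ) (p : ℕ → V) : ℕ → V := fun i => if i = 0 then x else
  if i = k then y else p i

theorem withEnds_zero {x y : V} : withEnds x y k p 0 = x := if_pos rfl

theorem withEnds_end {x y : V} (hk : k ≠ 0) : withEnds x y k p k = y := by simp [withEnds, hk]

theorem withEnds_of_lt {x y : V} {i : ℕ} (hi : 0 < i) (hik : i < k) :
    withEnds x y k p i = p i := by
  simp [withEnds, hi.ne', hik.ne]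

theorem isIndPath_withEnds {x y : V} (hk : 2 ≤ k)
    (inj : ∀ i j, 0 < i → i < k → 0 < j → j < k → p i = p j → i = j)
    (adj : ∀ i j, 0 < i → i < k → 0 < j → j < k → (G.Adj (p i) (p j) ↔ i + 1 = j ∨ j + 1 = i))
    (hx : ∀ i, 0 < i → i < k → x ≠ p i ∧ (G.Adj x (p i) ↔ i = 1))
    (hy : ∀ i, 0 < i → i < k → y ≠ p i ∧ (G.Adj y (p i) ↔ i + 1 = k))
    (hne : x ≠ y) (hnadj : ¬ G.Adj x y) : IsIndPath G k (withEnds x y k p) := by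
  have cases3 : ∀ i ≤ k, i = 0 ∨ i = k ∨ (0 < i ∧ i < k) := fun i hi => by omega
  refine ⟨fun i j hi hj => ?_, fun i j hi hj => ?_⟩
  · rcases cases3 i hi with rfl | rfl | ⟨hi0, hik⟩ <;> rcases cases3 j hj with rfl | rfl | ⟨hj0, hjk⟩
    · simp
    · rw [withEnds_zero, withEnds_end (by omega)]; exact fun h => absurd h hne
    · rw [withEnds_zero, withEnds_of_lt hj0 hjk]; exact fun h => absurd h (hx j hj0 hjk).1
    · rw [withEnds_zero, withEnds_end (by omega)]; exact fun h => absurd h.symm hne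
    · simp
    · rw [withEnds_end (by omega), withEnds_of_lt hj0 hjk]
      exact fun h => absurd h (hy j hj0 hjk).1
    · rw [withEnds_zero, withEnds_of_lt hi0 hik]; exact fun h => absurd h.symm (hx i hi0 hik).1
    · rw [withEnds_end (by omega), withEnds_of_lt hi0 hik]
      exact fun h => absurd h.symm (hy i hi0 hik).1
    · rw [withEnds_of_lt hi0 hik, withEnds_of_lt hj0 hjk]; exact inj i j hi0 hik hj0 hjk
  · rcases cases3 i hi with rfl | rfl | ⟨hi0, hik⟩ <;> rcases cases3 j hj with rfl | rfl | ⟨hj0, hjk⟩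
    · simp
    · rw [withEnds_zero, withEnds_end (by omega)]; exact iff_of_false hnadj (by omega)
    · rw [withEnds_zero, withEnds_of_lt hj0 hjk, (hx j hj0 hjk).2]; omega
    · rw [withEnds_zero, withEnds_end (by omega), G.adj_comm]; exact iff_of_false hnadj (by omega)
    · simp
    · rw [withEnds_end (by omega), withEnds_of_lt hj0 hjk, (hy j hj0 hjk).2]; omega
    · rw [withEnds_zero, withEnds_of_lt hi0 hik, G.adj_comm, (hx i hi0 hik).2]; omega
    · rw [withEnds_end (by omega), withEnds_of_lt hi0 hik, G.adj_comm, (hy i hi0 hik).2]; omega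
    · rw [withEnds_of_lt hi0 hik, withEnds_of_lt hj0 hjk]; exact adj i j hi0 hik hj0 hjk

theorem Ear.isIndPath (H : Ear G n f p k g h e) (hg : g < e) (hh : h < e) (he : 2 ≤ e)
    (hen : e + 2 ≤ n) : IsIndPath G k (withEnds (f 0) (f e) k p) := by
  have hk := H.two_le
  refine isIndPath_withEnds hk H.inj H.adj
    (fun i hi hik => ⟨(H.off i 0 hi hik (by omega)).symm, fun hadj => ?_, ?_⟩)
    (fun i hi hik => ⟨(H.off i e hi hik (by omega)).symm, fun hadj => ?_, ?_⟩)
    (fun heq => ?_) ?_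
  · have := H.nbr i 0 hi hik (by omega) hadj.symm; omega
  · rintro rfl; exact H.adj_zero.symm
  · have := H.nbr i e hi hik (by omega) hadj.symm; omega
  · rintro rfl; exact H.adj_end.symm
  · have := H.hole.inj _ _ (by omega) (by omega) heq; omega
  · rw [H.hole.adj _ _ (by omega) (by omega)]; omega

theorem Ear.anticomplete (H : Ear G n f p k g h e) (hg : g ≤ e) {i j : ℕ} (hi : 0 < i)
    (hik : i < k) (hj : e < j) (hjn : j < n) : p i ≠ f j ∧ ¬ G.Adj (p i) (f j) :=
  ⟨H.off i j hi hik hjn, fun hadj => by have := H.nbr i j hi hik hjn hadj; omega⟩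

/-- The ear and the arc `f 0, …, f e` are the two paths of different parity of a jewel, and the
complementary arc is its long path. Lengths at most `ℓ + 1` mean at most `ℓ + 2` vertices. -/
theorem Setting.not_ear_of_short (S : Setting G ℓ n) (H : Ear G n f p k g h e) (hg : g < e)
    (hh : h < e) (he : 2 ≤ e) (hpar : (e + k) % 2 = 1) (he' : e ≤ ℓ + 1) (hk' : k ≤ ℓ + 1)
    (hlong : ℓ ≤ n - e) : False := by
  have h5 := S.five_le
  have hk := H.two_le
  have hrefl : ∀ i, 0 < i → i < n → LongHole.reflect n 0 f i = f (n - i) := fun i hi hin =>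
    reflect_eq f hin (by omega) (by omega)
  refine S.no_jewel k e (n - e) (withEnds (f 0) (f e) k p) f (LongHole.reflect n 0 f)
    (H.isIndPath hg hh he (by omega)) (H.hole.arc (by omega))
    ((H.hole.reflect (by omega)).arc (by omega)) ?_ ?_ ?_ ?_ (by omega) hlong hk' he' ?_ ?_
  · rw [withEnds_zero, reflect_eq (j := 0) f (by omega) (by omega) (by omega)]
  · rw [reflect_eq (j := 0) f (by omega) (by omega) (by omega)]
  · rw [withEnds_end (by omega), reflect_eq (j := e) f (by omega) (by omega) (by omega)]
  · rw [reflect_eq (j := e) f (by omega) (by omega) (by omega)]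
  · intro i j hi hin hj hjk
    rw [hrefl i hi (by omega), withEnds_of_lt hj hjk]
    have := H.anticomplete hg.le (j := n - i) hj hjk (by omega) (by omega)
    exact ⟨this.1.symm, fun h => this.2 h.symm⟩
  · intro i j hi hin hj hjk
    rw [hrefl i hi (by omega), H.hole.adj _ _ (by omega) (by omega)]
    refine ⟨fun heq => ?_, by omega⟩
    have := H.hole.inj _ _ (by omega) (by omega) heq; omega

/-- Splicing the ear in place of `f 0, …, f e` gives a long odd hole, which cannot be shorter than
`n`. -/
theorem Setting.le_of_odd_ear (S : Setting G ℓ n) (H : Ear G n f p k g h e) (hg : g < e)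
    (hh : h < e) (he : 2 ≤ e) (hen : e + 2 ≤ n) (hodd : (n - e + k) % 2 = 1)
    (hlong : ℓ ≤ n - e + k) : e ≤ k := by
  have hk := H.two_le
  have := S.min _ _ (H.hole.splice (H.isIndPath hg hh he hen) withEnds_zero
    (withEnds_end (by omega)) (by omega) (by omega) (by omega) fun i j hi hik hj hjn => by
      rw [withEnds_of_lt hi hik]; exact H.anticomplete hg.le hi hik hj hjn) hodd hlong
  omega

/-- The odd cycle of length `n - e + k` is shorter than `n`, so it must be shorter than `ℓ`; its arc
is then short enough for a jewel. -/
theorem Setting.not_ear_of_even_aux (S : Setting G ℓ n) (H : Ear G n f p k g h e) (hg : g ≤ 2)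
    (hh : h ≤ 2) (hgh : (g + h) % 2 = 0) (hlt : g + h < e) (hk : k < e)
    (hk' : k < n - e + g + h) (hsmall : g + h ≤ 2 ∨ k ≤ 3) (hodd : (n - e + k) % 2 = 1) :
    False := by
  have h5 := S.five_le
  have hn := S.large
  have h2 := H.two_le
  have hen := H.lt
  have hshort : n - e + k < ℓ := by
    by_cases h1 : e + 2 ≤ n
    · by_contra hcon
      have := S.le_of_odd_ear H (by omega) (by omega) (by omega) h1 hodd (by omega)
      omega
    -- Here `e = n - 1`, so `hk'` and `hsmall` give `k ≤ 3`, and the cycle has length at most four.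
    · omega
  -- The jewel uses the arc of length `n - e + g + h`. Its bound `ℓ + 1` follows from `n - e + k <
  -- ℓ` and `hsmall`.
  exact S.not_ear_of_short (H.reflect hlt) (by omega) (by omega) (by omega) (by omega) (by omega)
    (by omega) (by omega)

/-- The lengths of the two cycles add up to `n + 2 * k - (g + h)`, which is odd, so exactly one of
them is odd; reflection makes it the outer one. -/
theorem Setting.not_ear_of_even (S : Setting G ℓ n) (H : Ear G n f p k g h e) (hg : g ≤ 2)
    (hh : h ≤ 2) (hgh : (g + h) % 2 = 0) (hlt : g + h < e) (hk : k < e)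
    (hk' : k < n - e + g + h) (hsmall : g + h ≤ 2 ∨ k ≤ 3) : False := by
  have hodd := S.odd
  have hen := H.lt
  by_cases hpar : (n - e + k) % 2 = 1
  · exact S.not_ear_of_even_aux H hg hh hgh hlt hk hk' hsmall hpar
  · exact S.not_ear_of_even_aux (H.reflect hlt) hg hh hgh (by omega) (by omega) (by omega) hsmall
      (by omega)

/-- The apex is `f e` and the base is the triangle `f 1`, `f 0`, `p 1`. The three paths are the two
arcs from `f e`, both long, and the reversed ear. -/
theorem Setting.not_ear_pyramid (S : Setting G ℓ n) (H : Ear G n f p k 1 0 e) (h1 : ℓ + 1 ≤ e)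
    (h2 : ℓ ≤ n - e) : False := by
  have h5 := S.five_le
  have hk := H.two_le
  have hen := H.lt
  have hdown : ∀ i ≤ e, LongHole.reflect n e f i = f (e - i) := fun i hi =>
    reflect_eq f (by omega) (by omega) (by omega)
  have hup : ∀ i ≤ n - e, ∃ j < n, (i + e = j ∨ i + e = j + n) ∧ rotate n e f i = f j := by
    intro i hi
    obtain ⟨j, hj, hij⟩ := exists_rotate_index hen i (by omega)
    exact ⟨j, hj, hij, rotate_eq f hj hij⟩
  have hr : ∀ i, 0 < i → i ≤ k - 1 → (if i = 0 then f e else p (k - i)) = p (k - i) :=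
    fun i hi _ => if_neg hi.ne'
  have hnbr : ∀ i j, 0 < i → i < k → j < n →
      p i ≠ f j ∧ (G.Adj (p i) (f j) ↔ (i = 1 ∧ (j = 0 ∨ j = 1)) ∨ (i + 1 = k ∧ j = e)) := by
    intro i j hi hik hj
    refine ⟨H.off i j hi hik hj, fun hadj => ?_, ?_⟩
    · have := H.nbr i j hi hik hj hadj; omega
    · rintro (⟨rfl, rfl | rfl⟩ | ⟨rfl, rfl⟩)
      exacts [H.adj_zero, H.adj_left, H.adj_end]
  refine S.no_pyramid (e - 1) (n - e) (k - 1) (LongHole.reflect n e f) (rotate n e f)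
    (fun i => if i = 0 then f e else p (k - i)) ((H.hole.reflect hen).arc (by omega))
    ((H.hole.rotate hen).arc (by omega)) ⟨fun i j hi hj hij => ?_, fun i j hi hj => ?_⟩ ?_ ?_
    (by omega) h2 (by omega) ?_ ?_ ?_
  · by_cases hi0 : i = 0 <;> by_cases hj0 : j = 0 <;> simp only [hi0, hj0, if_true, if_false] at hij
    · omega
    · exact absurd hij.symm (H.off _ _ (by omega) (by omega) hen)
    · exact absurd hij (H.off _ _ (by omega) (by omega) hen)
    · have := H.inj _ _ (by omega) (by omega) (by omega) (by omega) hij; omega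
  · by_cases hi0 : i = 0 <;> by_cases hj0 : j = 0 <;> simp only [hi0, hj0, if_true, if_false]
    · simp
    · rw [G.adj_comm, (hnbr _ _ (by omega) (by omega) hen).2]; omega
    · rw [(hnbr _ _ (by omega) (by omega) hen).2]; omega
    · rw [H.adj _ _ (by omega) (by omega) (by omega) (by omega)]; omega
  · rw [hdown 0 (by omega), rotate_eq (j := e) f hen (by omega)]; simp
  · simp [hdown 0 (by omega)]
  · intro i j hi hik hj hjk
    obtain ⟨j', hj', hjj, heq⟩ := hup j hjk
    rw [heq, hdown i (by omega), H.hole.adj _ _ (by omega) hj']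
    refine ⟨fun h => ?_, by omega⟩
    have := H.hole.inj _ _ (by omega) hj' h; omega
  · intro i j hi hik hj hjk
    simp only [hr j hj hjk]
    rw [hdown i (by omega), G.adj_comm]
    have := hnbr (k - j) (e - i) (by omega) (by omega) (by omega)
    rw [this.2]
    exact ⟨this.1.symm, by omega⟩
  · intro i j hi hik hj hjk
    obtain ⟨i', hi', hii, heq⟩ := hup i hik
    simp only [hr j hj hjk]
    rw [heq, G.adj_comm]
    have := hnbr (k - j) i' (by omega) (by omega) (by omega)
    rw [this.2]
    exact ⟨this.1.symm, by omega⟩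

theorem Setting.not_ear_of_odd (S : Setting G ℓ n) (H : Ear G n f p k 1 0 e) (hk : k < e)
    (hk' : k < n - e + 1) : False := by
  have hodd := S.odd
  have hn := S.large
  have h2 := H.two_le
  have hen := H.lt
  have short : ∀ f e, Ear G n f p k 1 0 e → k < e → e ≤ ℓ → False := by
    intro f e H hk he
    refine S.not_ear_of_short H (by omega) (by omega) (by omega) ?_ (by omega) (by omega) (by omega)
    -- With the wrong parity, splicing in the ear would give an odd hole that is still long but
    -- shorter than `n`.
    by_contra hpar
    have := S.le_of_odd_ear H (by omega) (by omega) (by omega) (by omega) (by omega) (by omega)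
    omega
  by_cases h1 : e ≤ ℓ
  · exact short _ _ H hk h1
  by_cases h3 : n - e < ℓ
  · exact short _ _ (H.reflect (by omega)) (by omega) (by omega)
  exact S.not_ear_pyramid H (by omega) (by omega)

/-- An ear with a single attachment or two adjacent ones at either end is not a shortcut. -/
theorem Setting.not_ear (S : Setting G ℓ n) (H : Ear G n f p k g h e) (hg : g ≤ 1) (hh : h ≤ 1)
    (hk : k < e) (hk' : k < n - e + g + h) : False := by
  have h2 := H.two_le
  rcases (by omega : (g + h) % 2 = 0 ∨ (g = 1 ∧ h = 0) ∨ (g = 0 ∧ h = 1)) with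
    h0 | ⟨rfl, rfl⟩ | ⟨rfl, rfl⟩
  · exact S.not_ear_of_even H (by omega) (by omega) h0 (by omega) hk hk' (by omega)
  · exact S.not_ear_of_odd H hk (by omega)
  · exact S.not_ear_of_odd H.swap hk (by omega)

end

section

/-! ### Distances between vertices of a clean hole -/

variable {V : Type*} {G : SimpleGraph V}

/-- In `G`, vertices of a clean hole of length `n` that are at distance at most `K` are as far
apart as in the hole. -/
def DistBound (G : SimpleGraph V) (n K : ℕ) : Prop :=
  ∀ f, IsHoleMap G n f → CleanMap G n f → ∀ i j k, i < n → j < n → k ≤ K → Within G k (f i) (f j) →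
    (i ≤ j + k ∧ j ≤ i + k) ∨ n + i ≤ j + k ∨ n + j ≤ i + k

/-- Replacing an arc of length at most `K`, shorter than its complement, of a clean hole of
length `n` by a walk of the same length produces a clean hole. -/
def Rerouting (G : SimpleGraph V) (n K : ℕ) : Prop :=
  ∀ f, IsHoleMap G n f → CleanMap G n f → ∀ d p, 2 ≤ d → d ≤ K → 2 * d < n → IsWalkMap G d p →
    p 0 = f 0 → p d = f d → IsHoleMap G n (splice d f d p) ∧ CleanMap G n (splice d f d p)

variable {ℓ n K d : ℕ} {f p : ℕ → V}

theorem IsWalkMap.reverse (hp : IsWalkMap G K p) : IsWalkMap G K fun i => p (K - i) := by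
  intro i hi
  have := (hp (K - (i + 1)) (by omega)).symm
  rwa [show K - (i + 1) + 1 = K - i by omega] at this

theorem IsGeodesic.reverse (hp : IsGeodesic G K p) : IsGeodesic G K fun i => p (K - i) :=
  ⟨hp.1.reverse, fun m hm => hp.2 m (by simpa using hm.symm)⟩

/-- This is rerouting with `d = 2`, along `f a`, `x`, `f b`, with the indices rotated back so that
only position `m` changes. -/
theorem Rerouting.exists_replace (R : Rerouting G n K) (hK : 2 ≤ K) (hn : 5 ≤ n)
    (hf : IsHoleMap G n f) (hc : CleanMap G n f) {a b m : ℕ} {x : V} (ha : a < n) (hb : b < n)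
    (hm : m < n) (ham : a + 1 = m ∨ a + 1 = m + n) (hmb : m + 1 = b ∨ m + 1 = b + n)
    (hxa : G.Adj x (f a)) (hxb : G.Adj x (f b)) :
    ∃ f', IsHoleMap G n f' ∧ CleanMap G n f' ∧ f' m = x ∧ ∀ i < n, i ≠ m → f' i = f i := by
  obtain ⟨hg, hgc⟩ := R _ (hf.rotate ha) (hc.rotate (by omega) ha) 2 (withEnds (f a) (f b) 2 fun _ => x)
    le_rfl hK (by omega) (by
      intro i hi
      rcases (by omega : i = 0 ∨ i = 1) with rfl | rfl
      · simpa [withEnds] using hxa.symm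
      · simpa [withEnds] using hxb)
    (by rw [rotate_eq (j := a) f ha (by omega), withEnds_zero])
    (by rw [rotate_eq (j := b) f hb (by omega), withEnds_end (by omega)])
  obtain ⟨c, hc', hmc⟩ : ∃ c < n, m + c = 1 ∨ m + c = 1 + n := by
    rcases (by omega : m = 0 ∨ m = 1 ∨ 2 ≤ m) with rfl | rfl | h
    exacts [⟨1, by omega, by omega⟩, ⟨0, by omega, by omega⟩, ⟨n + 1 - m, by omega, by omega⟩]
  refine ⟨_, hg.rotate hc', hgc.rotate (by omega) hc', ?_, fun i hi him => ?_⟩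
  · rw [rotate_eq (j := 1) _ (by omega) hmc, splice_of_le (by omega)]; rfl
  · obtain ⟨j, hj, hij⟩ := exists_rotate_index hc' i hi
    rw [rotate_eq _ hj hij]
    rcases (by omega : j = 0 ∨ j = 1 ∨ j = 2 ∨ 2 < j) with rfl | rfl | rfl | h
    · rw [splice_of_le (by omega), withEnds_zero]; congr 1; omega
    · omega
    · rw [splice_of_le (by omega), withEnds_end (by omega)]; congr 1; omega
    · rw [splice_of_lt (j := j) h rfl]; exact rotate_eq _ hi (by omega)

theorem exists_arc_of_pairwise_le {N : ℕ → Prop} {i : ℕ} (hi : N i)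
    (h : ∀ j j', N j → N j' → j ≤ j' + 1) :
    ∃ a g, g ≤ 1 ∧ N a ∧ N (a + g) ∧ ∀ j, N j → a ≤ j ∧ j ≤ a + g := by
  classical
  have hex : ∃ i, N i := ⟨i, hi⟩
  by_cases h1 : N (Nat.find hex + 1)
  · exact ⟨_, 1, le_rfl, Nat.find_spec hex, h1, fun j hj =>
      ⟨Nat.find_min' hex hj, h j _ hj (Nat.find_spec hex)⟩⟩
  · refine ⟨_, 0, by omega, Nat.find_spec hex, Nat.find_spec hex, fun j hj =>
      ⟨Nat.find_min' hex hj, ?_⟩⟩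
    have := h j _ hj (Nat.find_spec hex)
    have : j ≠ Nat.find hex + 1 := fun heq => h1 (heq ▸ hj)
    omega

/-- On a walk from `f 0` that is shorter than the arc `f 0, …, f d`, the vertex `p i` is not
adjacent to `f (i + 1)`. -/
theorem not_adj_of_walk (D : DistBound G n (K - 1)) (R : Rerouting G n (K - 1))
    (hf : IsHoleMap G n f) (hc : CleanMap G n f) (hp : IsWalkMap G K p) (h0 : p 0 = f 0)
    (hK : p K = f d) (hKd : K < d) (hdn : d < n) (hKdn : K + d ≤ n) {i : ℕ} (hi : 1 ≤ i)
    (hiK : i + 2 ≤ K) : ¬ G.Adj (p i) (f (i + 1)) := by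
  intro hadj
  -- Rerouting along `p 0, …, p i, f (i + 1)` puts `p i` at position `i` of a clean hole, from which
  -- the rest of the walk reaches `f d` too quickly. The non-strict bound `K + d ≤ n` is enough and
  -- is needed later for `d = K + 1`, `n = 2 * K + 1`.
  obtain ⟨hg, hgc⟩ := R f hf hc (i + 1) (fun t => if t ≤ i then p t else f (i + 1)) (by omega)
    (by omega) (by omega) (fun t ht => by
      rcases (by omega : t < i ∨ t = i) with h | rfl
      · simpa [h.le, show t + 1 ≤ i from h] using hp t (by omega)
      · simpa using hadj) (by simpa using h0) (by simp)
  have := D _ hg hgc i d (K - i) (by omega) hdn (by omega) (by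
    rw [splice_of_le (by omega), splice_of_lt (j := d) (by omega) rfl, if_pos le_rfl, ← hK]
    exact hp.within (by omega) le_rfl)
  omega

/-! ### A shortest walk that beats both arcs is impossible. -/

/-- A shortest walk between vertices of a clean hole which is shorter than both arcs. -/
structure Bad (G : SimpleGraph V) (n K d : ℕ) (f p : ℕ → V) : Prop where
  hole : IsHoleMap G n f
  clean : CleanMap G n f
  geodesic : IsGeodesic G K p
  zero : p 0 = f 0
  last : p K = f d
  lt : K < d
  add_lt : K + d < n

theorem Bad.reflect (B : Bad G n K d f p) : Bad G n K (n - d) (reflect n 0 f) p := by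
  have := B.lt
  have := B.add_lt
  refine ⟨B.hole.reflect (by omega), B.clean.reflect B.hole.four_le (by omega), B.geodesic, ?_, ?_,
    by omega, by omega⟩
  · rw [reflect_eq (j := 0) f (by omega) (by omega) (by omega), B.zero]
  · rw [reflect_eq (j := d) f (by omega) (by omega) (by omega), B.last]

theorem Bad.reverse (B : Bad G n K d f p) :
    Bad G n K d (LongHole.reflect n d f) fun i => p (K - i) := by
  have := B.lt
  have := B.add_lt
  refine ⟨B.hole.reflect (by omega), B.clean.reflect B.hole.four_le (by omega),
    B.geodesic.reverse, ?_, ?_, by omega, by omega⟩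
  · rw [reflect_eq (j := d) f (by omega) (by omega) (by omega)]; exact B.last
  · rw [reflect_eq (j := 0) f (by omega) (by omega) (by omega), Nat.sub_self, B.zero]

/-- A common vertex would be within `i` of `f 0` and within `K - i` of `f d` along the hole, making
one of the arcs too short. -/
theorem Bad.off (B : Bad G n K d f p) (D : DistBound G n (K - 1)) {i t : ℕ} (hi : 0 < i)
    (hiK : i < K) (ht : t < n) : p i ≠ f t := by
  have := B.lt
  have := B.add_lt
  intro heq
  have h1 := D f B.hole B.clean 0 t i (by omega) ht (by omega) (by
    rw [← B.zero, ← heq]; exact B.geodesic.1.within (Nat.zero_le i) hiK.le)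
  have h2 := D f B.hole B.clean t d (K - i) ht (by omega) (by omega) (by
    rw [← B.last, ← heq]; exact B.geodesic.1.within hiK.le le_rfl)
  omega

theorem Bad.not_adj_succ (B : Bad G n K d f p) (D : DistBound G n (K - 1))
    (R : Rerouting G n (K - 1)) {i : ℕ} (hi : 1 ≤ i) (hiK : i + 2 ≤ K) :
    ¬ G.Adj (p i) (f (i + 1)) := by
  have := B.lt
  have := B.add_lt
  exact not_adj_of_walk D R B.hole B.clean B.geodesic.1 B.zero B.last B.lt (by omega) (by omega) hi
    hiK

/-- The hole distances from `f t` to `f 0` and `f d` are at most `i + 1` and `K - i + 1`. Their sum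
is at least `K + 1`, so one of the bounds is attained, on one side or the other. Each of the four
cases is `Bad.not_adj_succ` up to symmetry. -/
theorem Bad.not_adj_middle (B : Bad G n K d f p) (D : DistBound G n (K - 1))
    (R : Rerouting G n (K - 1)) {i t : ℕ} (hi : 2 ≤ i) (hiK : i + 2 ≤ K) (ht : t < n) :
    ¬ G.Adj (p i) (f t) := by
  have := B.lt
  have := B.add_lt
  intro hadj
  have h1 := D f B.hole B.clean 0 t (i + 1) (by omega) ht (by omega) (by
    rw [← B.zero]; exact (B.geodesic.1.within (Nat.zero_le i) (by omega)).trans (.of_adj hadj))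
  have h2 := D f B.hole B.clean t d (1 + (K - i)) ht (by omega) (by omega) (by
    rw [← B.last]
    exact (Within.of_adj hadj.symm).trans (B.geodesic.1.within (by omega) le_rfl))
  have hKi : K - (K - i) = i := by omega
  rcases (by omega : t = i + 1 ∨ t + i + 1 = n ∨ t + (K - i) + 1 = d ∨
    (t = d + (K - i) + 1 ∨ t + n = d + (K - i) + 1)) with h | h | h | h
  · exact B.not_adj_succ D R (by omega) hiK (h ▸ hadj)
  · refine B.reflect.not_adj_succ D R (i := i) (by omega) hiK ?_
    rwa [reflect_eq (j := t) f (by omega) ht (by omega)]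
  · refine B.reverse.not_adj_succ D R (i := K - i) (by omega) (by omega) ?_
    simp only [hKi]
    rwa [reflect_eq (j := t) f (by omega) ht (by omega)]
  · refine B.reverse.reflect.not_adj_succ D R (i := K - i) (by omega) (by omega) ?_
    simp only [hKi]
    rwa [reflect_eq (j := n - (K - i + 1)) _ (by omega) (by omega) (by omega),
      reflect_eq (j := t) f (by omega) ht (by omega)]

/-- If `p 1` had two neighbours at distance two on the hole, it could replace the vertex between
them. In the new hole it is next to or in the place of `f 0`, yet within `K - 1` of `f d`. -/
theorem Bad.adj_one_close (B : Bad G n K d f p) (D : DistBound G n (K - 1))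
    (R : Rerouting G n (K - 1)) (hK : 3 ≤ K) {a b : ℕ} (ha : a < n) (hb : b < n)
    (hpa : G.Adj (p 1) (f a)) (hpb : G.Adj (p 1) (f b)) :
    (a ≤ b + 1 ∧ b ≤ a + 1) ∨ n ≤ a + 1 - b ∨ n ≤ b + 1 - a := by
  have hKd := B.lt
  have hKdn := B.add_lt
  have hp0 : G.Adj (p 1) (f 0) := B.zero ▸ (B.geodesic.1 0 (by omega)).symm
  have key : ∀ a b m, a < n → b < n → m < n → G.Adj (p 1) (f a) → G.Adj (p 1) (f b) →
      (a + 1 = m ∨ a + 1 = m + n) → (m + 1 = b ∨ m + 1 = b + n) → False := by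
    intro a b m ha hb hm hpa hpb ham hmb
    obtain ⟨f', hf', hc', hfm, hfi⟩ := R.exists_replace (by omega) (by omega) B.hole B.clean ha hb hm
      ham hmb hpa hpb
    have h1 : m = 0 ∨ m = 1 ∨ m + 1 = n := by
      by_cases hm0 : m = 0
      · exact .inl hm0
      · have := D f' hf' hc' 0 m 1 (by omega) hm (by omega) (by
          rw [hfm, hfi 0 (by omega) (by omega)]; exact .of_adj hp0.symm)
        omega
    have := D f' hf' hc' m d (K - 1) hm (by omega) le_rfl (by
      rw [hfm, hfi d (by omega) (by omega), ← B.last]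
      exact B.geodesic.1.within (by omega) le_rfl)
    omega
  have h2 := D f B.hole B.clean a b (1 + 1) ha hb (by omega)
    ((Within.of_adj hpa.symm).trans (.of_adj hpb))
  by_contra hcon
  rcases (by omega : a + 2 = b ∨ a + 2 = b + n ∨ b + 2 = a ∨ b + 2 = a + n) with h | h | h | h
  · exact key a b (a + 1) ha hb (by omega) hpa hpb (by omega) (by omega)
  · by_cases h' : a + 1 < n
    · exact key a b (a + 1) ha hb (by omega) hpa hpb (by omega) (by omega)
    · exact key a b 0 ha hb (by omega) hpa hpb (by omega) (by omega)
  · exact key b a (b + 1) hb ha (by omega) hpb hpa (by omega) (by omega)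
  · by_cases h' : b + 1 < n
    · exact key b a (b + 1) hb ha (by omega) hpb hpa (by omega) (by omega)
    · exact key b a 0 hb ha (by omega) hpb hpa (by omega) (by omega)

theorem Bad.false_of_three_le (B : Bad G n K d f p) (S : Setting G ℓ n)
    (D : DistBound G n (K - 1)) (R : Rerouting G n (K - 1)) (hK : 3 ≤ K) : False := by
  classical
  have hKd := B.lt
  have hKdn := B.add_lt
  have hind := B.geodesic.isIndPath
  have hp0 : G.Adj (p 1) (f 0) := B.zero ▸ (B.geodesic.1 0 (by omega)).symm
  have hpd : G.Adj (p (K - 1)) (f d) := by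
    have := B.geodesic.1 (K - 1) (by omega)
    rwa [show K - 1 + 1 = K by omega, B.last] at this
  have hclose := fun a b => B.adj_one_close D R hK (a := a) (b := b)
  have hclose' : ∀ a b, a < n → b < n → G.Adj (p (K - 1)) (f a) → G.Adj (p (K - 1)) (f b) →
      (a ≤ b + 1 ∧ b ≤ a + 1) ∨ n ≤ a + 1 - b ∨ n ≤ b + 1 - a := by
    intro a b ha hb hpa hpb
    obtain ⟨a', ha', haa⟩ := exists_reflect_index (show d < n by omega) a ha
    obtain ⟨b', hb', hbb⟩ := exists_reflect_index (show d < n by omega) b hb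
    have := B.reverse.adj_one_close D R hK ha' hb'
      (by rwa [reflect_eq (j := a) f ha' ha (by omega)])
      (by rwa [reflect_eq (j := b) f hb' hb (by omega)])
    omega
  -- The attachment arc of `p 1` contains `f 0` and may start at `f (n - 1)`; `s` records this
  -- shift. The arc at the other end cannot wrap around, as `d` is far from both `0` and `n`.
  obtain ⟨a, g, s, hg, hsa, hsg, hadja, hadjg, hN⟩ : ∃ a g s, g ≤ 1 ∧
      ((a = 0 ∧ s = 0) ∨ (a + 1 = n ∧ s = 1)) ∧ s ≤ g ∧ G.Adj (p 1) (f a) ∧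
      G.Adj (p 1) (f (g - s)) ∧ ∀ t < n, G.Adj (p 1) (f t) → t + s ≤ g ∨ t = a := by
    by_cases h1 : G.Adj (p 1) (f (n - 1))
    · refine ⟨n - 1, 1, 1, le_rfl, by omega, le_rfl, h1, hp0, fun t ht hadj => ?_⟩
      have := hclose t 0 ht (by omega) hadj hp0
      have := hclose t (n - 1) ht (by omega) hadj h1
      omega
    by_cases h2 : G.Adj (p 1) (f 1)
    · refine ⟨0, 1, 0, le_rfl, by omega, by omega, hp0, h2, fun t ht hadj => ?_⟩
      have := hclose t 0 ht (by omega) hadj hp0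
      have := hclose t 1 ht (by omega) hadj h2
      omega
    · refine ⟨0, 0, 0, by omega, by omega, le_rfl, hp0, hp0, fun t ht hadj => ?_⟩
      have := hclose t 0 ht (by omega) hadj hp0
      have : t ≠ 1 := fun h => h2 (h ▸ hadj)
      have : t ≠ n - 1 := fun h => h1 (h ▸ hadj)
      omega
  obtain ⟨b, h, hh, ⟨hbn, hadjb⟩, ⟨hbhn, hadjh⟩, hM⟩ :=
    exists_arc_of_pairwise_le (N := fun t => t < n ∧ G.Adj (p (K - 1)) (f t)) (i := d)
      ⟨by omega, hpd⟩ (by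
        rintro j j' ⟨hj, hadj⟩ ⟨hj', hadj'⟩
        have := hclose' j d hj (by omega) hadj hpd
        have := hclose' j' d hj' (by omega) hadj' hpd
        have := hclose' j j' hj hj' hadj hadj'
        omega)
  have hbd := hM d ⟨by omega, hpd⟩
  have hbd' := hclose' b d hbn (by omega) hadjb hpd
  have hbd'' := hclose' (b + h) d hbhn (by omega) hadjh hpd
  have han : a < n := by omega
  refine S.not_ear (f := rotate n a f) (p := p) (k := K) (g := g) (h := h) (e := b + h + s)
    ⟨B.hole.rotate han, by omega, fun i j hi hik hj hjk => hind.inj i j hik.le hjk.le,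
      fun i j hi hik hj hjk => hind.adj i j hik.le hjk.le, fun i j hi hik hj => ?_,
      fun i j hi hik hj => ?_, ?_, ?_, ?_, ?_, by omega, by omega⟩ hg hh (by omega) (by omega)
  · obtain ⟨j', hj', hjj⟩ := exists_rotate_index han j hj
    rw [rotate_eq f hj' hjj]; exact B.off D hi hik hj'
  · obtain ⟨j', hj', hjj⟩ := exists_rotate_index han j hj
    rw [rotate_eq f hj' hjj]
    intro hadj
    rcases (by omega : i = 1 ∨ i = K - 1 ∨ (2 ≤ i ∧ i + 2 ≤ K)) with rfl | rfl | ⟨h2, h3⟩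
    · have := hN j' hj' hadj; omega
    · have := hM j' ⟨hj', hadj⟩; omega
    · exact absurd hadj (B.not_adj_middle D R h2 h3 hj')
  · rwa [rotate_eq (j := a) f han (by omega)]
  · rwa [rotate_eq (j := g - s) f (by omega) (by omega)]
  · rwa [rotate_eq (j := b + h) f hbhn (by omega)]
  · rwa [rotate_eq (j := b) f hbn (by omega)]

theorem Bad.false (B : Bad G n K d f p) (S : Setting G ℓ n)
    (D : DistBound G n (K - 1)) (R : Rerouting G n (K - 1)) : False := by
  have hKd := B.lt
  have hKdn := B.add_lt
  rcases (by omega : K = 0 ∨ K = 1 ∨ K = 2 ∨ 3 ≤ K) with rfl | rfl | rfl | hK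
  · have := B.hole.inj 0 d (by omega) (by omega) (B.zero.symm.trans B.last)
    omega
  · have := B.geodesic.1 0 (by omega)
    rw [B.zero, zero_add, B.last, B.hole.adj _ _ (by omega) (by omega)] at this
    omega
  -- With `K = 2` no rerouting is available, but cleanness alone forbids a vertex adjacent to both
  -- `f 0` and `f d`.
  · have h1 := (B.geodesic.1 0 (by omega)).symm
    have h2 := B.geodesic.1 1 (by omega)
    rw [B.zero] at h1
    rw [B.last] at h2
    obtain ⟨c, hc, hnbr⟩ := B.clean (p 1) fun j hj => B.off D (by omega) (by omega) hj
    have := hnbr 0 (by omega) h1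
    have := hnbr d (by omega) h2
    omega
  · exact B.false_of_three_le S D R hK

/-- A violation at length exactly `K`, with no shorter walk, becomes `Bad` after rotation. -/
theorem Setting.distBound (S : Setting G ℓ n) (D : DistBound G n (K - 1))
    (R : Rerouting G n (K - 1)) : DistBound G n K := by
  intro f hf hc i j k hi hj hk hw
  by_cases hkK : k ≤ K - 1
  · exact D f hf hc i j k hi hj hkK hw
  obtain rfl : k = K := by omega
  by_cases hlow : ∃ m < k, Within G m (f i) (f j)
  · obtain ⟨m, hm, hwm⟩ := hlow
    have := D f hf hc i j m hi hj (by omega) hwm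
    omega
  push Not at hlow
  by_contra hcon
  obtain ⟨w, hwk⟩ := hw
  have hwlen : w.length = k := by
    by_contra h
    exact hlow w.length (by omega) ⟨w, le_rfl⟩
  obtain ⟨d, hd, hdi⟩ := exists_unrotate_index hi j hj
  refine Bad.false (K := k) (d := d) (f := rotate n i f) (p := w.getVert) ⟨hf.rotate hi,
    hc.rotate hf.four_le hi, ⟨fun t ht => w.adj_getVert_succ (by omega), fun m hm => ?_⟩, ?_, ?_,
    by omega, by omega⟩ S D R
  · by_contra h
    refine hlow m (by omega) ?_
    rwa [← hwlen, Walk.getVert_zero, Walk.getVert_length] at hm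
  · rw [Walk.getVert_zero, rotate_eq (j := i) f hi (by omega)]
  · rw [← hwlen, Walk.getVert_length, rotate_eq f hj hdi]

end

section

/-! ### Shortest walks as long as an arc of a clean hole: the new hole is induced -/

variable {V : Type*} {G : SimpleGraph V}

variable {ℓ n K : ℕ} {f p : ℕ → V}

/-- A shortest walk between the ends of the shorter arc `f 0, …, f K` of a clean hole, with the
same length. -/
structure Tight (G : SimpleGraph V) (n K : ℕ) (f p : ℕ → V) : Prop where
  hole : IsHoleMap G n f
  clean : CleanMap G n f
  geodesic : IsGeodesic G K p
  zero : p 0 = f 0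
  last : p K = f K
  two_le : 2 ≤ K
  lt : 2 * K < n

theorem Tight.reverse (T : Tight G n K f p) : Tight G n K (reflect n K f) fun i => p (K - i) := by
  have := T.lt
  refine ⟨T.hole.reflect (by omega), T.clean.reflect T.hole.four_le (by omega),
    T.geodesic.reverse, ?_, ?_, T.two_le, T.lt⟩
  · rw [reflect_eq (j := K) f (by omega) (by omega) (by omega)]; exact T.last
  · rw [reflect_eq (j := 0) f (by omega) (by omega) (by omega), Nat.sub_self, T.zero]

theorem Tight.eq_of_eq (T : Tight G n K f p) (D : DistBound G n K) {i t : ℕ} (hi : i ≤ K)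
    (ht : t < n) (heq : p i = f t) : t = i := by
  have := T.lt
  have h1 := D f T.hole T.clean 0 t i (by omega) ht (by omega) (by
    rw [← T.zero, ← heq]; exact T.geodesic.1.within (Nat.zero_le i) hi)
  have h2 := D f T.hole T.clean t K (K - i) ht (by omega) (by omega) (by
    rw [← T.last, ← heq]; exact T.geodesic.1.within hi le_rfl)
  omega

/-- Distances to `f 0` and `f K` force `n ≤ 2 * K + 2`, and oddness gives `n = 2 * K + 1`. The
complementary arc then has length `K + 1 > K`, so `not_adj_of_walk` applies to it from either end
and leaves only the two extreme edges. -/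
theorem Tight.adj_outer (T : Tight G n K f p) (D : DistBound G n K) (R : Rerouting G n (K - 1))
    (hn : n % 2 = 1) {i t : ℕ} (hi : 0 < i) (hiK : i < K) (hKt : K < t) (ht : t < n)
    (hadj : G.Adj (p i) (f t)) :
    n = 2 * K + 1 ∧ ((i = 1 ∧ t + 1 = n) ∨ (i + 1 = K ∧ t = K + 1)) := by
  have hK2 := T.lt
  have D' : DistBound G n (K - 1) := fun f hf hc i j k hi hj hk =>
    D f hf hc i j k hi hj (by omega)
  have h1 := D f T.hole T.clean 0 t (i + 1) (by omega) ht (by omega) (by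
    rw [← T.zero]; exact (T.geodesic.1.within (Nat.zero_le i) (by omega)).trans (.of_adj hadj))
  have h2 := D f T.hole T.clean t K (1 + (K - i)) ht (by omega) (by omega) (by
    rw [← T.last]
    exact (Within.of_adj hadj.symm).trans (T.geodesic.1.within (by omega) le_rfl))
  obtain rfl : n = 2 * K + 1 := by omega
  refine ⟨rfl, ?_⟩
  rcases (by omega : t + i = 2 * K ∨ t + i = 2 * K + 1) with h | h
  · by_cases hlast : i + 2 ≤ K
    · refine absurd ?_ (not_adj_of_walk D' R (T.hole.reflect (c := 0) (by omega))
        (T.clean.reflect T.hole.four_le (c := 0) (by omega)) T.geodesic.1 (d := K + 1) ?_ ?_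
        (by omega) (by omega) (by omega) hi hlast)
      · rwa [reflect_eq (j := t) f (by omega) ht (by omega)]
      · rw [reflect_eq (j := 0) f (by omega) (by omega) (by omega), T.zero]
      · rw [reflect_eq (j := K) f (by omega) (by omega) (by omega), T.last]
    · omega
  · by_cases hfirst : 2 ≤ i
    · refine absurd ?_ (not_adj_of_walk D' R (T.hole.rotate (c := K) (by omega))
        (T.clean.rotate T.hole.four_le (c := K) (by omega)) T.geodesic.1.reverse (d := K + 1) ?_ ?_
        (by omega) (by omega) (by omega) (i := K - i) (by omega) (by omega))
      · rw [rotate_eq (j := t) f ht (by omega)]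
        rwa [show K - (K - i) = i by omega]
      · rw [rotate_eq (j := K) f (by omega) (by omega)]; exact T.last
      · rw [rotate_eq (j := 0) f (by omega) (by omega), Nat.sub_self, T.zero]
    · omega

/-- With both extreme edges present, the path from `f (n - 1)` to `f (K + 1)` through the interior
of `p` bypasses an arc of length `K + 2`, giving a long odd hole of length `n - 2`. -/
theorem Tight.not_adj_both (T : Tight G n K f p) (S : Setting G ℓ n) (D : DistBound G n K)
    (R : Rerouting G n (K - 1)) (h1 : G.Adj (p 1) (f (n - 1))) :
    ¬ G.Adj (p (K - 1)) (f (K + 1)) := by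
  intro h2
  have hK2 := T.two_le
  have hlt := T.lt
  have h5 := S.five_le
  have hlarge := S.large
  have hn := (T.adj_outer D R S.odd (by omega) (by omega) (by omega) (by omega) h1).1
  have hind := T.geodesic.isIndPath
  have hxy : ∀ t i, K < t → t < n → 0 < i → i < K → f t ≠ p i := fun t i hKt ht hi hiK heq => by
    have := T.eq_of_eq D hiK.le ht heq.symm; omega
  have hq : IsIndPath G K (withEnds (f (n - 1)) (f (K + 1)) K p) := by
    refine isIndPath_withEnds hK2 (fun i j hi hik hj hjk => hind.inj i j hik.le hjk.le)
      (fun i j hi hik hj hjk => hind.adj i j hik.le hjk.le)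
      (fun i hi hik => ⟨hxy _ i (by omega) (by omega) hi hik, fun hadj => ?_, ?_⟩)
      (fun i hi hik => ⟨hxy _ i (by omega) (by omega) hi hik, fun hadj => ?_, ?_⟩)
      (fun heq => ?_) ?_
    · have := T.adj_outer D R S.odd hi hik (by omega) (by omega) hadj.symm; omega
    · rintro rfl; exact h1.symm
    · have := T.adj_outer D R S.odd hi hik (by omega) (by omega) hadj.symm; omega
    · rintro rfl; exact h2.symm
    · have := T.hole.inj _ _ (by omega) (by omega) heq; omega
    · rw [T.hole.adj _ _ (by omega) (by omega)]; omega
  have hsplice := (T.hole.rotate (c := n - 1) (by omega)).splice (d := K + 2) hq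
    (by rw [rotate_eq (j := n - 1) f (by omega) (by omega), withEnds_zero])
    (by rw [rotate_eq (j := K + 1) f (by omega) (by omega), withEnds_end (by omega)])
    (by omega) (by omega) (by omega) (fun i j hi hik hj hjn => by
      rw [withEnds_of_lt hi hik, rotate_eq (j := j - 1) f (by omega) (by omega)]
      refine ⟨(hxy _ i (by omega) (by omega) hi hik).symm, fun hadj => ?_⟩
      have := T.adj_outer D R S.odd hi hik (by omega) (by omega) hadj
      omega)
  have := S.min _ _ hsplice (by omega) (by omega)
  omega

theorem Tight.not_adj_pred (T : Tight G n K f p) (S : Setting G ℓ n) (D : DistBound G n K)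
    (R : Rerouting G n (K - 1)) : ¬ G.Adj (p 1) (f (n - 1)) := by
  intro h1
  have hK2 := T.two_le
  have hlt := T.lt
  have h5 := S.five_le
  have hlarge := S.large
  have hn := (T.adj_outer D R S.odd (by omega) (by omega) (by omega) (by omega) h1).1
  have hind := T.geodesic.isIndPath
  have hp0 : G.Adj (p 1) (f 0) := T.zero ▸ (T.geodesic.1 0 (by omega)).symm
  have hq : ∀ i, 0 < i → (if i = 0 then f (n - 1) else p i) = p i := fun i hi => if_neg hi.ne'
  -- Since `n = 2 * K + 1`, the arc from `f (n - 1)` down to `f K` also has length `K`, so starting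
  -- `p` at `f (n - 1)` gives a second tight pair. It controls the edges from `p` to the original
  -- arc, which makes `p` an ear attached at the edge `f (n - 1)`, `f 0` and at `f K`.
  have T' : Tight G n K (reflect n (n - 1) f) (fun i => if i = 0 then f (n - 1) else p i) := by
    refine ⟨T.hole.reflect (by omega), T.clean.reflect T.hole.four_le (by omega),
      ⟨fun i hi => ?_, fun m hm => ?_⟩, ?_, ?_, hK2, hlt⟩
    · rcases Nat.eq_zero_or_pos i with rfl | hi0
      · simpa using h1.symm
      · simpa [hi0.ne'] using T.geodesic.1 i hi
    · beta_reduce at hm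
      rw [if_pos rfl, hq K (by omega), T.last] at hm
      by_contra hcon
      have := D f T.hole T.clean (n - 1) K m (by omega) (by omega) (by omega) hm
      omega
    · rw [reflect_eq (j := n - 1) f (by omega) (by omega) (by omega), if_pos rfl]
    · rw [reflect_eq (j := K) f (by omega) (by omega) (by omega), hq K (by omega), T.last]
  have hno := T.not_adj_both S D R h1
  have hno' := T'.not_adj_both S D R (by
    rw [reflect_eq (j := 0) f (by omega) (by omega) (by omega)]; simpa using hp0)
  rw [reflect_eq (j := K - 1) f (by omega) (by omega) (by omega)] at hno'
  simp only [hq (K - 1) (by omega)] at hno'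
  have hnbr : ∀ i t, 0 < i → i < K → t < n → G.Adj (p i) (f t) →
      (i = 1 ∧ (t = 0 ∨ t = n - 1)) ∨ (i + 1 = K ∧ t = K) := by
    intro i t hi hiK ht hadj
    rcases lt_trichotomy t K with h | rfl | h
    · have := T'.adj_outer D R S.odd hi hiK (t := n - 1 - t) (by omega) (by omega) (by
        rw [reflect_eq (j := t) f (by omega) (by omega) (by omega)]
        simpa only [hq i hi] using hadj)
      have : i + 1 = K → t ≠ K - 1 := by
        rintro rfl rfl; exact hno' hadj
      omega
    · rw [← T.last, hind.adj _ _ (by omega) le_rfl] at hadj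
      omega
    · have := T.adj_outer D R S.odd hi hiK h ht hadj
      have : i + 1 = K → t ≠ K + 1 := by
        rintro rfl rfl; exact hno hadj
      omega
  have hoff : ∀ i t, 0 < i → i < K → t < n → p i ≠ f t := by
    intro i t hi hiK ht heq
    obtain rfl := T.eq_of_eq D hiK.le ht heq
    by_cases h : t = 1
    · subst h
      rw [heq, T.hole.adj _ _ (by omega) (by omega)] at h1
      omega
    · have hadj := T.geodesic.1 (t - 1) (by omega)
      rw [show t - 1 + 1 = t by omega, heq] at hadj
      have := hnbr (t - 1) t (by omega) (by omega) ht hadj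
      omega
  have hr : n - 1 < n := by omega
  refine S.not_ear (f := rotate n (n - 1) f) (p := p) (k := K) (g := 1) (h := 0) (e := K + 1)
    ⟨T.hole.rotate hr, by omega, fun i j hi hik hj hjk => hind.inj i j hik.le hjk.le,
      fun i j hi hik hj hjk => hind.adj i j hik.le hjk.le, fun i j hi hik hj => ?_,
      fun i j hi hik hj => ?_, ?_, ?_, ?_, ?_, by omega, by omega⟩ le_rfl (by omega) (by omega)
      (by omega)
  · obtain ⟨j', hj', hjj⟩ := exists_rotate_index hr j hj
    rw [rotate_eq f hj' hjj]; exact hoff i j' hi hik hj'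
  · obtain ⟨j', hj', hjj⟩ := exists_rotate_index hr j hj
    rw [rotate_eq f hj' hjj]
    intro hadj
    have := hnbr i j' hi hik hj' hadj
    omega
  · rwa [rotate_eq (j := n - 1) f hr (by omega)]
  · rwa [rotate_eq (j := 0) f (by omega) (by omega)]
  all_goals
    rw [rotate_eq (j := K) f (by omega) (by omega), ← T.last, hind.adj _ _ (by omega) le_rfl]
    omega

theorem Tight.not_adj_outer (T : Tight G n K f p) (S : Setting G ℓ n) (D : DistBound G n K)
    (R : Rerouting G n (K - 1)) {i t : ℕ} (hi : 0 < i) (hiK : i < K) (hKt : K < t) (ht : t < n) :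
    ¬ G.Adj (p i) (f t) := by
  intro hadj
  obtain ⟨hn, ⟨rfl, h⟩ | ⟨h, rfl⟩⟩ := T.adj_outer D R S.odd hi hiK hKt ht hadj
  · obtain rfl : t = n - 1 := by omega
    exact T.not_adj_pred S D R hadj
  · refine T.reverse.not_adj_pred S D R ?_
    rw [reflect_eq (j := K + 1) f (by omega) (by omega) (by omega)]
    rwa [show K - 1 = i by omega]

theorem Tight.isHoleMap_splice (T : Tight G n K f p) (S : Setting G ℓ n) (D : DistBound G n K)
    (R : Rerouting G n (K - 1)) : IsHoleMap G n (splice K f K p) := by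
  have hK2 := T.two_le
  have hlt := T.lt
  have h4 := T.hole.four_le
  have := T.hole.splice T.geodesic.isIndPath T.zero T.last (by omega) (by omega) (by omega)
    fun i j hi hik hj hjn => ⟨fun heq => by
      have := T.eq_of_eq D hik.le hjn heq; omega, T.not_adj_outer S D R hi hik hj hjn⟩
  rwa [Nat.sub_add_cancel (by omega)] at this

end

section

/-! ### The new hole is clean -/

variable {V : Type*} {G : SimpleGraph V}

variable {ℓ n K : ℕ} {f p : ℕ → V}

theorem Tight.splice_of_ge (T : Tight G n K f p) {i : ℕ} (hi : K ≤ i) :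
    splice K f K p i = f i := by
  rcases hi.eq_or_lt with rfl | h
  · rw [splice_of_le le_rfl, T.last]
  · exact splice_of_lt h rfl

/-- Two adjacent vertices, one attached at two vertices at distance two of a hole, the other at
another such pair. -/
theorem Setting.not_two_diamonds (S : Setting G ℓ n) (hf : IsHoleMap G n f)
    (hc : CleanMap G n f) {x y : V} {m : ℕ} (hm : 3 ≤ m) (hmn : m + 1 < n)
    (hx : ∀ j < n, x ≠ f j) (hy : ∀ j < n, y ≠ f j) (hxy : G.Adj y x) (hy0 : G.Adj y (f 0))
    (hy2 : G.Adj y (f 2)) (hxm : G.Adj x (f (m - 1))) (hxm' : G.Adj x (f (m + 1))) : False := by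
  have h5 := S.five_le
  have hlarge := S.large
  have hodd := S.odd
  have H : Ear G n f (fun i => if i = 1 then y else x) 3 2 2 (m + 1) := by
    have cases2 : ∀ i, 0 < i → i < 3 → i = 1 ∨ i = 2 := fun i _ _ => by omega
    refine ⟨hf, by omega, fun i j hi hik hj hjk => ?_, fun i j hi hik hj hjk => ?_,
      fun i j hi hik hj => ?_, fun i j hi hik hj hadj => ?_, hy0, hy2, hxm',
      by simpa using hxm, by omega, hmn⟩
    · rcases cases2 i hi hik with rfl | rfl <;> rcases cases2 j hj hjk with rfl | rfl <;>
        simp [hxy.ne, hxy.ne']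
    · rcases cases2 i hi hik with rfl | rfl <;> rcases cases2 j hj hjk with rfl | rfl <;>
        simp [hxy, hxy.symm]
    · rcases cases2 i hi hik with rfl | rfl
      exacts [hy j hj, hx j hj]
    · rcases cases2 i hi hik with rfl | rfl
      · obtain ⟨c, hcn, hnbr⟩ := hc y hy
        have := hnbr 0 (by omega) hy0
        have := hnbr 2 (by omega) hy2
        have := hnbr j hj hadj
        omega
      · obtain ⟨c, hcn, hnbr⟩ := hc x hx
        have := hnbr _ (by omega) hxm
        have := hnbr _ (by omega) hxm'
        have := hnbr j hj hadj
        omega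
  -- For `m = 3` the two attachment arcs share `f 2`, so the reflected ear does not exist; but `e +
  -- k = 7` is odd and the jewel is immediate.
  by_cases h3 : m = 3
  · subst h3
    exact S.not_ear_of_short H (by omega) (by omega) (by omega) (by omega) (by omega) (by omega)
      (by omega)
  · exact S.not_ear_of_even H (by omega) (by omega) (by omega) (by omega) (by omega) (by omega)
      (by omega)

theorem Tight.adj_path_close (T : Tight G n K f p) {x : V} {a b : ℕ} (ha : a ≤ K) (hb : b ≤ K)
    (hxa : G.Adj x (p a)) (hxb : G.Adj x (p b)) : a ≤ b + 2 ∧ b ≤ a + 2 := by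
  have := T.geodesic.le_of_within ha hb ((Within.of_adj hxa.symm).trans (.of_adj hxb))
  omega

/-- Neighbours on a geodesic span at most three consecutive vertices; the centre is the successor of
the first. -/
theorem Tight.exists_center_of_path (T : Tight G n K f p) {x : V}
    (h : ∀ j < n, G.Adj x (splice K f K p j) → j ≤ K) :
    ∃ c < n, ∀ j < n, G.Adj x (splice K f K p j) →
      j = c ∨ c + 1 = j ∨ j + 1 = c ∨ (c = 0 ∧ j + 1 = n) ∨ (j = 0 ∧ c + 1 = n) := by
  classical
  have hlt := T.lt
  have h4 := T.hole.four_le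
  by_cases hex : ∃ j, j < n ∧ G.Adj x (splice K f K p j)
  · obtain ⟨hfn, hfadj⟩ := Nat.find_spec hex
    have hle := h _ hfn hfadj
    refine ⟨Nat.find hex + 1, by omega, fun j hj hadj => ?_⟩
    have h1 := Nat.find_min' hex ⟨hj, hadj⟩
    have hjK := h j hj hadj
    rw [splice_of_le hle] at hfadj
    rw [splice_of_le hjK] at hadj
    have := T.adj_path_close hle hjK hfadj hadj
    omega
  · exact ⟨0, by omega, fun j hj hadj => absurd ⟨j, hj, hadj⟩ hex⟩

/-- Were `p b` and `p (b + 2)` both neighbours, `x` could replace `p (b + 1)`, giving a tight walk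
with an interior edge to the complementary arc. -/
theorem Tight.adj_path_close' (T : Tight G n K f p) (S : Setting G ℓ n) (D : DistBound G n K)
    (R : Rerouting G n (K - 1)) {x : V} {t a b : ℕ} (hKt : K < t) (ht : t < n)
    (hxt : G.Adj x (f t)) (ha : a ≤ K) (hb : b ≤ K) (hxa : G.Adj x (p a)) (hxb : G.Adj x (p b)) :
    a ≤ b + 1 := by
  by_contra hcon
  have := T.adj_path_close ha hb hxa hxb
  obtain rfl : a = b + 2 := by omega
  have T' : Tight G n K f (fun i => if i = b + 1 then x else p i) := by
    refine ⟨T.hole, T.clean, ⟨fun i hi => ?_, fun m hm => ?_⟩, by simpa using T.zero, ?_, T.two_le,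
      T.lt⟩
    · by_cases h1 : i = b + 1
      · subst h1; simpa using hxa
      by_cases h2 : i = b
      · subst h2; simpa using hxb.symm
      simpa [h1, h2] using T.geodesic.1 i hi
    · refine T.geodesic.2 m ?_
      simpa [show K ≠ b + 1 by omega] using hm
    · simpa [show K ≠ b + 1 by omega] using T.last
  exact T'.not_adj_outer S D R (i := b + 1) (by omega) (by omega) hKt ht (by simpa using hxt)

/-- A vertex with a neighbour inside the path does not have two neighbours, at distance two, on
the arc complementary to the path. -/
theorem Tight.not_adj_two_apart (T : Tight G n K f p) (S : Setting G ℓ n) (D : DistBound G n K)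
    (R : Rerouting G n (K - 1)) {x : V} (hx : ∀ j < n, x ≠ f j) {i m b : ℕ} (hi : 0 < i)
    (hiK : i < K) (hxi : G.Adj x (p i)) (hKm : K < m) (hm : m < n) (hb : b < n)
    (hmb : m + 1 = b ∨ m + 1 = b + n) (hxa : G.Adj x (f (m - 1))) : ¬ G.Adj x (f b) := by
  intro hxb
  have hK2 := T.two_le
  have hlt := T.lt
  have hlarge := S.large
  have h5 := S.five_le
  -- For `K ≥ 3`, `x` may replace `f m`, and the edge to `p i` contradicts `Tight.not_adj_outer`.
  -- For `K = 2` the induction gives no rerouting, and `p 1` and `x` form two diamonds instead.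
  by_cases hK : 3 ≤ K
  · obtain ⟨f', hf', hc', hfm, hfi⟩ := R.exists_replace (a := m - 1) (b := b) (m := m) (by omega)
      (by omega) T.hole T.clean (by omega) hb hm (by omega) hmb hxa hxb
    have T' : Tight G n K f' p := ⟨hf', hc', T.geodesic,
      by rw [hfi 0 (by omega) (by omega), T.zero], by rw [hfi K (by omega) (by omega), T.last],
      hK2, hlt⟩
    exact T'.not_adj_outer S D R hi hiK hKm hm (by rw [hfm]; exact hxi.symm)
  · obtain rfl : K = 2 := by omega
    obtain rfl : i = 1 := by omega
    have hp0 : G.Adj (p 1) (f 0) := T.zero ▸ (T.geodesic.1 0 (by omega)).symm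
    have hp2 : G.Adj (p 1) (f 2) := T.last ▸ (T.geodesic.1 1 (by omega))
    have hoff : ∀ j < n, p 1 ≠ f j := by
      intro j hj heq
      obtain rfl := T.eq_of_eq D (by omega) hj heq
      obtain ⟨c, hcn, hnbr⟩ := T.clean x hx
      have := hnbr 1 hj (heq ▸ hxi)
      have := hnbr (m - 1) (by omega) hxa
      have := hnbr b hb hxb
      omega
    rcases hmb with rfl | hmb
    · exact S.not_two_diamonds T.hole T.clean (by omega) hb hx hoff hxi.symm hp0 hp2 hxa hxb
    · have hr : 2 < n := by omega
      refine S.not_two_diamonds (T.hole.reflect hr) (T.clean.reflect T.hole.four_le hr) (m := 3)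
        le_rfl (by omega) (x := x) (y := p 1) (fun j hj => ?_) (fun j hj => ?_) hxi.symm ?_ ?_ ?_ ?_
      · obtain ⟨j', hj', hjj⟩ := exists_reflect_index hr j hj
        rw [reflect_eq f hj hj' hjj]; exact hx j' hj'
      · obtain ⟨j', hj', hjj⟩ := exists_reflect_index hr j hj
        rw [reflect_eq f hj hj' hjj]; exact hoff j' hj'
      · rwa [reflect_eq (j := 2) f (by omega) (by omega) (by omega)]
      · rwa [reflect_eq (j := 0) f (by omega) (by omega) (by omega)]
      · rwa [reflect_eq (j := b) f (by omega) (by omega) (by omega)]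
      · rwa [reflect_eq (j := m - 1) f (by omega) (by omega) (by omega)]

/-- By cleanness, non-consecutive neighbours are the two sides of a centre `c`. Either they are `f
0` and `f K` with `K = 2`, too far apart on the path, or `c > K` and `Tight.not_adj_two_apart`
applies. -/
theorem Tight.adj_hole_close (T : Tight G n K f p) (S : Setting G ℓ n) (D : DistBound G n K)
    (R : Rerouting G n (K - 1)) {x : V} (hx : ∀ j < n, x ≠ f j) {i t a b : ℕ} (hi : 0 < i)
    (hiK : i < K) (hxi : G.Adj x (p i)) (hKt : K < t) (ht : t < n) (hxt : G.Adj x (f t)) (han : a < n) (hbn : b < n) (ha : a = 0 ∨ K ≤ a)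
    (hb : b = 0 ∨ K ≤ b) (hxa : G.Adj x (f a)) (hxb : G.Adj x (f b)) :
    (a ≤ b + 1 ∧ b ≤ a + 1) ∨ n ≤ a + 1 - b ∨ n ≤ b + 1 - a := by
  have hK2 := T.two_le
  have hlt := T.lt
  have hlarge := S.large
  have h5 := S.five_le
  obtain ⟨c, hcn, hnbr⟩ := T.clean x hx
  have h1 := hnbr a han hxa
  have h2 := hnbr b hbn hxb
  have hends : ¬ (G.Adj x (f 0) ∧ G.Adj x (f K)) := fun ⟨h0, hK⟩ => by
    have := T.adj_path_close' S D R hKt ht hxt le_rfl (Nat.zero_le K) (T.last ▸ hK) (T.zero ▸ h0)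
    omega
  by_contra hcon
  have key := fun m b => T.not_adj_two_apart S D R hx (m := m) (b := b) hi hiK hxi
  rcases (by omega : (a = 0 ∧ b = K) ∨ (b = 0 ∧ a = K) ∨ (K ≤ a ∧ a + 1 = c) ∨
    (K ≤ b ∧ b + 1 = c)) with ⟨rfl, rfl⟩ | ⟨rfl, rfl⟩ | ⟨h, h'⟩ | ⟨h, h'⟩
  · exact hends ⟨hxa, hxb⟩
  · exact hends ⟨hxb, hxa⟩
  · obtain rfl : a = c - 1 := by omega
    exact key c b (by omega) hcn hbn (by omega) hxa hxb
  · obtain rfl : b = c - 1 := by omega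
    exact key c a (by omega) hcn han (by omega) hxb hxa

theorem Tight.cleanMap_splice (T : Tight G n K f p) (S : Setting G ℓ n) (D : DistBound G n K)
    (R : Rerouting G n (K - 1)) : CleanMap G n (splice K f K p) := by
  have hK2 := T.two_le
  have hlt := T.lt
  have hlarge := S.large
  have h5 := S.five_le
  have hg := T.isHoleMap_splice S D R
  have hle := fun i => splice_of_le (d := K) (f := f) (p := p) (k := K) (i := i)
  have hge := fun i => T.splice_of_ge (i := i)
  have hg0 : splice K f K p 0 = f 0 := by rw [hle 0 (by omega), T.zero]
  intro x hxg
  -- A vertex dropped from the old hole is some `f t` with `0 < t < K`, so its neighbours on the new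
  -- hole all lie on `p`.
  by_cases hx : ∃ t < n, x = f t
  · obtain ⟨t, ht, rfl⟩ := hx
    refine T.exists_center_of_path fun j hj hadj => ?_
    by_contra hjK
    rw [hge j (by omega), T.hole.adj _ _ ht hj] at hadj
    have h0 : t ≠ 0 := by rintro rfl; exact hxg 0 (by omega) hg0.symm
    have hK : t < K := by
      by_contra h; exact hxg t ht (hge t (by omega)).symm
    omega
  replace hx : ∀ j < n, x ≠ f j := fun j hj h => hx ⟨j, hj, h⟩
  by_cases hcross : ∃ t, (K < t ∧ t < n) ∧ G.Adj x (f t)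
  swap
  · refine T.exists_center_of_path fun j hj hadj => ?_
    by_contra hjK
    rw [hge j (by omega)] at hadj
    exact hcross ⟨j, ⟨by omega, hj⟩, hadj⟩
  by_cases hin : ∃ i, (0 < i ∧ i < K) ∧ G.Adj x (p i)
  swap
  · obtain ⟨c, hcn, hnbr⟩ := T.clean x hx
    refine ⟨c, hcn, fun j hj hadj => hnbr j hj ?_⟩
    rcases (by omega : j = 0 ∨ K ≤ j ∨ (0 < j ∧ j < K)) with rfl | h | h
    · rwa [hg0] at hadj
    · rwa [hge j h] at hadj
    · rw [hle j (by omega)] at hadj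
      exact absurd ⟨j, h, hadj⟩ hin
  obtain ⟨t, ⟨hKt, ht⟩, hxt⟩ := hcross
  obtain ⟨i, ⟨hi, hiK⟩, hxi⟩ := hin
  have hI : ∀ a b, a ≤ K → b ≤ K → G.Adj x (splice K f K p a) → G.Adj x (splice K f K p b) →
      a ≤ b + 1 := fun a b ha hb hxa hxb => by
    rw [hle a ha] at hxa
    rw [hle b hb] at hxb
    exact T.adj_path_close' S D R hKt ht hxt ha hb hxa hxb
  have hJ : ∀ a b, a < n → b < n → (a = 0 ∨ K ≤ a) → (b = 0 ∨ K ≤ b) →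
      G.Adj x (splice K f K p a) → G.Adj x (splice K f K p b) →
      (a ≤ b + 1 ∧ b ≤ a + 1) ∨ n ≤ a + 1 - b ∨ n ≤ b + 1 - a := by
    intro a b han hbn ha hb hxa hxb
    have hgf : ∀ a, (a = 0 ∨ K ≤ a) → splice K f K p a = f a := by
      rintro a (rfl | h)
      exacts [hg0, hge a h]
    rw [hgf a ha] at hxa
    rw [hgf b hb] at hxb
    exact T.adj_hole_close S D R hx hi hiK hxi hKt ht hxt han hbn ha hb hxa hxb
  rw [← hle i hiK.le] at hxi
  rw [← hge t hKt.le] at hxt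
  -- An end of `p` adjacent to `x` belongs to both arcs, so closeness on each arc makes it a centre.
  by_cases hx0 : G.Adj x (splice K f K p 0)
  · refine ⟨0, by omega, fun j hj hadj => ?_⟩
    by_cases hjK : j ≤ K
    · have := hI j 0 hjK (by omega) hadj hx0; omega
    · have := hJ j 0 hj (by omega) (by omega) (by omega) hadj hx0; omega
  by_cases hxK : G.Adj x (splice K f K p K)
  · refine ⟨K, by omega, fun j hj hadj => ?_⟩
    by_cases hjK : j ≤ K
    · have := hI j K hjK le_rfl hadj hxK
      have := hI K j le_rfl hjK hxK hadj
      omega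
    · have := hJ j K hj (by omega) (by omega) (by omega) hadj hxK; omega
  obtain ⟨a, g, hg1, ⟨⟨ha0, haK⟩, hxa⟩, ⟨⟨-, hagK⟩, hxag⟩, hIN⟩ := exists_arc_of_pairwise_le
    (N := fun j => (0 < j ∧ j < K) ∧ G.Adj x (splice K f K p j)) ⟨⟨hi, hiK⟩, hxi⟩
    fun j j' h h' => hI j j' h.1.2.le h'.1.2.le h.2 h'.2
  obtain ⟨b, h, hh1, ⟨⟨hKb, -⟩, hxb⟩, ⟨⟨-, hbhn⟩, hxbh⟩, hJN⟩ := exists_arc_of_pairwise_le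
    (N := fun j => (K < j ∧ j < n) ∧ G.Adj x (splice K f K p j)) ⟨⟨hKt, ht⟩, hxt⟩
    fun j j' h h' => by
      have := hJ j j' h.1.2 h'.1.2 (by omega) (by omega) h.2 h'.2
      omega
  have hall : ∀ j < n, G.Adj x (splice K f K p j) → (a ≤ j ∧ j ≤ a + g) ∨ (b ≤ j ∧ j ≤ b + h) := by
    intro j hj hadj
    rcases (by omega : j = 0 ∨ j = K ∨ (0 < j ∧ j < K) ∨ (K < j ∧ j < n)) with rfl | rfl | h | h
    · exact absurd hadj hx0
    · exact absurd hadj hxK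
    · exact .inl (hIN j ⟨h, hadj⟩)
    · exact .inr (hJN j ⟨h, hadj⟩)
  by_cases hs : b + h ≤ a + 2
  · refine ⟨K, by omega, fun j hj hadj => ?_⟩
    have := hall j hj hadj
    omega
  by_cases hs' : n + a + g ≤ b + 2
  · refine ⟨0, by omega, fun j hj hadj => ?_⟩
    have := hall j hj hadj
    omega
  have han : a < n := by omega
  -- The single vertex `x` is the whole interior of an ear with `k = 2`, attached to the new hole.
  refine (S.not_ear (f := rotate n a (splice K f K p)) (p := fun _ => x) (k := 2) (g := g) (h := h)
    (e := b + h - a) ⟨hg.rotate han, le_rfl, fun i j hi hik hj hjk _ => by omega,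
      fun i j hi hik hj hjk => ?_, fun i j hi hik hj => ?_, fun i j hi hik hj => ?_, ?_, ?_, ?_, ?_,
      by omega, by omega⟩ hg1 hh1 (by omega) (by omega)).elim
  · exact iff_of_false (fun h => h.ne rfl) (by omega)
  · obtain ⟨j', hj', hjj⟩ := exists_rotate_index han j hj
    rw [rotate_eq _ hj' hjj]; exact hxg j' hj'
  · obtain ⟨j', hj', hjj⟩ := exists_rotate_index han j hj
    rw [rotate_eq _ hj' hjj]
    intro hadj
    have := hall j' hj' hadj
    omega
  · rwa [rotate_eq (j := a) _ han (by omega)]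
  · rwa [rotate_eq (j := a + g) _ (by omega) (by omega)]
  · rwa [rotate_eq (j := b + h) _ hbhn (by omega)]
  · rwa [rotate_eq (j := b) _ (by omega) (by omega)]

theorem Setting.rerouting (S : Setting G ℓ n) (D : DistBound G n K)
    (R : Rerouting G n (K - 1)) : Rerouting G n K := by
  intro f hf hc d p hd hdK hdn hp h0 hpd
  by_cases hdK' : d ≤ K - 1
  · exact R f hf hc d p hd hdK' hdn hp h0 hpd
  obtain rfl : d = K := by omega
  have T : Tight G n d f p := by
    refine ⟨hf, hc, ⟨hp, fun m hm => ?_⟩, h0, hpd, hd, hdn⟩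
    by_contra hcon
    rw [h0, hpd] at hm
    have := D f hf hc 0 d m (by omega) (by omega) (by omega) hm
    omega
  exact ⟨T.isHoleMap_splice S D R, T.cleanMap_splice S D R⟩

theorem Setting.distBound_and_rerouting (S : Setting G ℓ n) (K : ℕ) :
    DistBound G n K ∧ Rerouting G n K := by
  induction K with
  | zero =>
    have R : Rerouting G n 0 := fun f hf hc d p hd hd0 => by omega
    refine ⟨fun f hf hc i j k hi hj hk hw => ?_, R⟩
    obtain ⟨w, hw⟩ := hw
    have := hf.inj i j hi hj (w.eq_of_length_eq_zero (by omega))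
    omega
  | succ K ih =>
    -- The order matters: rerouting at `K + 1` uses the distance bound at `K + 1` but rerouting only
    -- at `K`.
    have D := S.distBound (K := K + 1) ih.1 ih.2
    exact ⟨D, S.rerouting D ih.2⟩

end

section

/-! ### From sequences of vertices to subgraphs and walks -/

variable {V : Type*} {G : SimpleGraph V}

variable {ℓ n k : ℕ} {f p : ℕ → V}

theorem IsHole.exists_isHoleMap {C : G.Subgraph} (h : IsHole C n) :
    ∃ f, IsHoleMap G n f ∧ ∀ x, x ∈ C.verts ↔ ∃ i < n, x = f i := by
  obtain ⟨hind, h4, a, c, hc, rfl, rfl⟩ := h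
  have hend : c.getVert c.length = c.getVert 0 := by rw [Walk.getVert_length, Walk.getVert_zero]
  have hinj : ∀ i j, i < c.length → j < c.length → c.getVert i = c.getVert j → i = j :=
    fun i j hi hj h => hc.getVert_injOn' (by simp; omega) (by simp; omega) h
  have hmem : ∀ i, c.getVert i ∈ c.toSubgraph.verts := fun i =>
    c.mem_verts_toSubgraph.2 (c.getVert_mem_support i)
  refine ⟨c.getVert, ⟨h4, hinj, fun i j hi hj => ?_⟩, fun x => ?_⟩
  · rw [show G.Adj (c.getVert i) (c.getVert j) ↔ c.toSubgraph.Adj (c.getVert i) (c.getVert j) from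
      ⟨fun h => hind (hmem i) (hmem j) h, fun h => h.adj_sub⟩, Walk.toSubgraph_adj_iff]
    have hsucc : ∀ t < c.length, ∃ t' < c.length, c.getVert (t + 1) = c.getVert t' ∧
        (t' = t + 1 ∨ (t' = 0 ∧ t + 1 = c.length)) := by
      intro t ht
      by_cases h : t + 1 < c.length
      · exact ⟨t + 1, h, rfl, .inl rfl⟩
      · obtain h : t + 1 = c.length := by omega
        exact ⟨0, by omega, by rw [h, hend], .inr ⟨rfl, h⟩⟩
    constructor
    · rintro ⟨t, heq, ht⟩
      obtain ⟨t', ht', he, h⟩ := hsucc t ht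
      rw [he, Sym2.eq_iff] at heq
      rcases heq with ⟨h1, h2⟩ | ⟨h1, h2⟩
      · have := hinj _ _ ht hi h1
        have := hinj _ _ ht' hj h2
        omega
      · have := hinj _ _ ht hj h1
        have := hinj _ _ ht' hi h2
        omega
    · rintro (rfl | rfl | ⟨rfl, h⟩ | ⟨rfl, h⟩)
      · exact ⟨i, rfl, hi⟩
      · exact ⟨j, Sym2.eq_swap, hj⟩
      · exact ⟨j, by rw [h, hend, Sym2.eq_swap], hj⟩
      · exact ⟨i, by rw [h, hend], hi⟩
  · rw [Walk.mem_verts_toSubgraph, Walk.mem_support_iff_exists_getVert]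
    constructor
    · rintro ⟨i, rfl, hi⟩
      rcases hi.lt_or_eq with h | rfl
      · exact ⟨i, h, rfl⟩
      · exact ⟨0, by omega, hend⟩
    · rintro ⟨i, hi, rfl⟩
      exact ⟨i, rfl, hi.le⟩

theorem IsHoleMap.isHole (hf : IsHoleMap G n f) {C : G.Subgraph} (hC : C.IsInduced)
    (hverts : ∀ x, x ∈ C.verts ↔ ∃ i < n, x = f i) : IsHole C n := by
  have h4 := hf.four_le
  have hw : IsWalkMap G (n - 1) f := fun i hi => (hf.adj _ _ (by omega) (by omega)).2 (.inl rfl)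
  obtain ⟨w, hlen, hget⟩ := hw.exists_walk
  have hclose : G.Adj (f (n - 1)) (f 0) := (hf.adj _ _ (by omega) (by omega)).2 (by omega)
  have hpath : w.IsPath := by
    rw [← Walk.IsPath.getVert_injOn_iff]
    intro i hi j hj hij
    simp only [Set.mem_ofPred_eq, hlen] at hi hj
    rw [hget i hi, hget j hj] at hij
    exact hf.inj _ _ (by omega) (by omega) hij
  have hadj : ∀ x y, w.toSubgraph.Adj x y ↔ ∃ i, i + 1 < n ∧ s(f i, f (i + 1)) = s(x, y) := by
    intro x y
    rw [Walk.toSubgraph_adj_iff]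
    constructor
    · rintro ⟨i, heq, hi⟩
      rw [hget i (by omega), hget (i + 1) (by omega)] at heq
      exact ⟨i, by omega, heq⟩
    · rintro ⟨i, hi, heq⟩
      exact ⟨i, by rw [hget i (by omega), hget (i + 1) (by omega), heq], by omega⟩
  have hsupp : ∀ x, x ∈ w.support ↔ ∃ i < n, x = f i := by
    intro x
    rw [Walk.mem_support_iff_exists_getVert]
    constructor
    · rintro ⟨i, rfl, hi⟩
      exact ⟨i, by omega, hget i (by omega)⟩
    · rintro ⟨i, hi, rfl⟩
      exact ⟨i, hget i (by omega), by omega⟩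
  refine ⟨hC, h4, _, .cons hclose w, ?_, by simp [hlen]; omega, ?_⟩
  · rw [Walk.cons_isCycle_iff]
    refine ⟨hpath, fun hmem => ?_⟩
    rw [← Walk.adj_toSubgraph_iff_mem_edges, hadj] at hmem
    obtain ⟨i, hi, heq⟩ := hmem
    rcases Sym2.eq_iff.1 heq with ⟨h1, h2⟩ | ⟨h1, h2⟩
    · have := hf.inj _ _ (by omega) (by omega) h1; omega
    · have := hf.inj _ _ (by omega) (by omega) h1
      have := hf.inj _ _ (by omega) (by omega) h2
      omega
  · have hv : (Walk.cons hclose w).toSubgraph.verts = C.verts := by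
      ext x
      rw [Walk.mem_verts_toSubgraph, Walk.support_cons, List.mem_cons, hsupp, hverts]
      exact ⟨fun h => h.elim (fun h => ⟨n - 1, by omega, h⟩) id, .inr⟩
    refine Subgraph.ext hv ?_
    funext x y
    refine propext ⟨fun h => ?_, fun h => ?_⟩
    · exact hC (hv ▸ h.fst_mem) (hv ▸ h.snd_mem) h.adj_sub
    · obtain ⟨i, hi, rfl⟩ := (hverts x).1 h.fst_mem
      obtain ⟨j, hj, rfl⟩ := (hverts y).1 h.snd_mem
      have h' := (hf.adj i j hi hj).1 h.adj_sub
      simp only [Walk.toSubgraph, Subgraph.sup_adj, subgraphOfAdj_adj]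
      rcases h' with rfl | rfl | ⟨rfl, h'⟩ | ⟨rfl, h'⟩
      · exact .inr ((hadj _ _).2 ⟨i, hj, rfl⟩)
      · exact .inr ((hadj _ _).2 ⟨j, hi, Sym2.eq_swap⟩)
      · exact .inl (by rw [show n - 1 = j by omega]; exact Sym2.eq_swap)
      · exact .inl (by rw [show n - 1 = i by omega])

theorem IsHoleMap.exists_isHole (hf : IsHoleMap G n f) : ∃ C : G.Subgraph, IsHole C n :=
  ⟨(⊤ : G.Subgraph).induce {x | ∃ i < n, x = f i}, hf.isHole
    (fun _ hx _ hy hadj => ⟨hx, hy, by simpa using hadj⟩) fun _ => Iff.rfl⟩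

/-- The centre in `CleanMap` is the middle vertex of the three-vertex path. -/
theorem IsHoleMap.isClean_iff (hf : IsHoleMap G n f) {C : G.Subgraph} (hC : C.IsInduced)
    (hverts : ∀ x, x ∈ C.verts ↔ ∃ i < n, x = f i) : IsClean C ↔ CleanMap G n f := by
  have h4 := hf.four_le
  have hmem : ∀ i < n, f i ∈ C.verts := fun i hi => (hverts _).2 ⟨i, hi, rfl⟩
  have hadj : ∀ i j, i < n → j < n → G.Adj (f i) (f j) → C.Adj (f i) (f j) :=
    fun i j hi hj h => hC (hmem i hi) (hmem j hj) h
  constructor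
  · intro h x hx
    have hx' : x ∉ C.verts := fun hmem => by
      obtain ⟨j, hj, rfl⟩ := (hverts x).1 hmem
      exact hx j hj rfl
    have := h x
    rw [IsMajor, not_and_not_right] at this
    obtain ⟨a, b, c, hab, hbc, -, hnbr⟩ := this hx'
    obtain ⟨i, hi, rfl⟩ := (hverts a).1 hab.fst_mem
    obtain ⟨m, hm, rfl⟩ := (hverts b).1 hab.snd_mem
    obtain ⟨t, ht, rfl⟩ := (hverts c).1 hbc.snd_mem
    have h1 := (hf.adj _ _ hi hm).1 hab.adj_sub
    have h2 := (hf.adj _ _ hm ht).1 hbc.adj_sub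
    refine ⟨m, hm, fun j hj hxj => ?_⟩
    rcases hnbr _ (hmem j hj) hxj with heq | heq | heq
    · have := hf.inj _ _ hj hi heq; omega
    · have := hf.inj _ _ hj hm heq; omega
    · have := hf.inj _ _ hj ht heq; omega
  · rintro h x ⟨hx, hmaj⟩
    obtain ⟨c, hc, hnbr⟩ := h x fun j hj heq => hx (heq ▸ hmem j hj)
    obtain ⟨a, ha, hac⟩ : ∃ a < n, a + 1 = c ∨ (c = 0 ∧ a + 1 = n) := by
      by_cases h0 : c = 0
      exacts [⟨n - 1, by omega, by omega⟩, ⟨c - 1, by omega, by omega⟩]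
    obtain ⟨b, hb, hcb⟩ : ∃ b < n, c + 1 = b ∨ (b = 0 ∧ c + 1 = n) := by
      by_cases h0 : c + 1 = n
      exacts [⟨0, by omega, by omega⟩, ⟨c + 1, by omega, by omega⟩]
    refine hmaj ⟨f a, f c, f b, hadj a c ha hc ((hf.adj _ _ ha hc).2 (by omega)),
      hadj c b hc hb ((hf.adj _ _ hc hb).2 (by omega)), fun heq => ?_, fun y hy hxy => ?_⟩
    · have := hf.inj _ _ ha hb heq; omega
    · obtain ⟨j, hj, rfl⟩ := (hverts y).1 hy
      rcases (by have := hnbr j hj hxy; omega : j = a ∨ j = c ∨ j = b) with rfl | rfl | rfl <;> simp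

theorem IsIndPath.exists_walk (hp : IsIndPath G k p) {u v : V} (hu : p 0 = u) (hv : p k = v) :
    ∃ w : G.Walk u v, w.length = k ∧ IsInducedPath w ∧ (∀ x ∈ w.support, ∃ i ≤ k, x = p i) ∧
      ∀ x ∈ interior w, ∃ i, 0 < i ∧ i < k ∧ x = p i := by
  subst hu hv
  obtain ⟨w, hlen, hget⟩ := hp.isWalkMap.exists_walk
  have hsupp : ∀ x ∈ w.support, ∃ i ≤ k, x = p i := by
    intro x hx
    obtain ⟨i, rfl, hi⟩ := Walk.mem_support_iff_exists_getVert.1 hx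
    exact ⟨i, by omega, hget i (by omega)⟩
  refine ⟨w, hlen, ⟨?_, ?_⟩, hsupp, ?_⟩
  · rw [← Walk.IsPath.getVert_injOn_iff]
    intro i hi j hj hij
    simp only [Set.mem_ofPred_eq, hlen] at hi hj
    rw [hget i hi, hget j hj] at hij
    exact hp.inj _ _ hi hj hij
  · intro x hx y hy hadj
    obtain ⟨i, hi, rfl⟩ := hsupp x (w.mem_verts_toSubgraph.1 hx)
    obtain ⟨j, hj, rfl⟩ := hsupp y (w.mem_verts_toSubgraph.1 hy)
    rcases (hp.adj i j hi hj).1 hadj with rfl | rfl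
    · rw [← hget i hi, ← hget _ hj]
      exact w.toSubgraph_adj_getVert (by omega)
    · rw [← hget j hj, ← hget _ hi]
      exact (w.toSubgraph_adj_getVert (by omega)).symm
  · rintro x ⟨hx, h0, hk⟩
    obtain ⟨i, hi, rfl⟩ := hsupp x hx
    have : i ≠ 0 := fun h => h0 (h ▸ rfl)
    have : i ≠ k := fun h => hk (h ▸ rfl)
    exact ⟨i, by omega, by omega, rfl⟩

theorem setting_of_forall (hℓ : 5 ≤ ℓ) (hjewel : ¬ HasLongJewel G ℓ (ℓ + 2))
    (hpyramid : ¬ HasLongPyramid G ℓ) (hlarge : 2 * ℓ + 3 ≤ n) (hodd : n % 2 = 1)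
    (hmin : ∀ (C : G.Subgraph) (m : ℕ), IsLongOddHole ℓ C m → n ≤ m) : Setting G ℓ n := by
  refine ⟨hℓ, hlarge, hodd, fun m f hf hm hℓm => ?_, ?_, ?_⟩
  · obtain ⟨C, hC⟩ := hf.exists_isHole
    exact hmin C m ⟨hC, hℓm, Nat.odd_iff.2 hm⟩
  · intro k₁ k₂ k q₁ q₂ q h₁ h₂ h h10 h20 h1k h2k hpar hlong hk₁ hk₂ ha₁ ha₂
    obtain ⟨w₁, hl₁, hw₁, -, hi₁⟩ := h₁.exists_walk h10 h1k
    obtain ⟨w₂, hl₂, hw₂, -, hi₂⟩ := h₂.exists_walk h20 h2k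
    obtain ⟨w, hl, hw, -, hi⟩ := h.exists_walk rfl rfl
    refine hjewel ⟨_, _, w₁, w₂, w, ⟨hw₁, hw₂, ?_, hw, by omega, fun x hx y hy => ?_⟩, ?_⟩
    · rw [hl₁, hl₂, Nat.even_iff, Nat.even_iff]; omega
    · obtain ⟨i, hi0, hik, rfl⟩ := hi x hx
      rcases hy with hy | hy
      · obtain ⟨j, hj0, hjk, rfl⟩ := hi₁ y hy
        exact ha₁ i j hi0 hik hj0 hjk
      · obtain ⟨j, hj0, hjk, rfl⟩ := hi₂ y hy
        exact ha₂ i j hi0 hik hj0 hjk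
    · rw [Walk.length_support, Walk.length_support]; omega
  · intro k₀ k₁ k₂ p₀ p₁ p₂ h₀ h₁ h₂ h10 h20 hk₀ hk₁ hk₂ h01 h02 h12
    let K : Fin 3 → ℕ := ![k₀, k₁, k₂]
    let P : Fin 3 → ℕ → V := ![p₀, p₁, p₂]
    have hP : ∀ i, IsIndPath G (K i) (P i) := by
      intro i; fin_cases i; exacts [h₀, h₁, h₂]
    have hP0 : ∀ i, P i 0 = p₀ 0 := by
      intro i; fin_cases i; exacts [rfl, h10, h20]
    have hK : ∀ i, 1 ≤ K i := by
      intro i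
      fin_cases i
      exacts [(by omega : 1 ≤ k₀), (by omega : 1 ≤ k₁), hk₂]
    have hlt : ∀ i j, i < j → ∀ s t, 0 < s → s ≤ K i → 0 < t → t ≤ K j →
        P i s ≠ P j t ∧ (G.Adj (P i s) (P j t) ↔ s = K i ∧ t = K j) := by
      intro i j hij
      fin_cases i <;> fin_cases j <;> first | exact absurd hij (by decide) | skip
      exacts [h01, h02, h12]
    have hne : ∀ i j, i ≠ j → ∀ s t, 0 < s → s ≤ K i → 0 < t → t ≤ K j →
        P i s ≠ P j t ∧ (G.Adj (P i s) (P j t) ↔ s = K i ∧ t = K j) := by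
      intro i j hij s t hs hsK ht htK
      rcases lt_or_gt_of_ne hij with h | h
      · exact hlt i j h s t hs hsK ht htK
      · have := hlt j i h t s ht htK hs hsK
        exact ⟨this.1.symm, by rw [G.adj_comm, this.2, and_comm]⟩
    choose w hl hw hsupp hint using fun i => (hP i).exists_walk (hP0 i) rfl
    have hsupp' : ∀ i x, x ∈ (w i).support → x ≠ p₀ 0 → ∃ s, 0 < s ∧ s ≤ K i ∧ x = P i s := by
      intro i x hx hx0
      obtain ⟨s, hs, rfl⟩ := hsupp i x hx
      have : s ≠ 0 := fun h => hx0 (by rw [h, hP0])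
      exact ⟨s, by omega, hs, rfl⟩
    refine hpyramid ⟨p₀ 0, fun i => P i (K i), w, hw, fun i j hij x hxi hxj => ?_, fun i => ?_,
      ⟨0, 1, by decide, ?_, ?_⟩, fun i j hij => ?_, fun i j hij x hx y hy hx0 hy0 hadj => ?_⟩
    · by_contra hx0
      obtain ⟨s, hs, hsK, rfl⟩ := hsupp' i x hxi hx0
      obtain ⟨t, ht, htK, heq⟩ := hsupp' j _ hxj hx0
      exact (hne i j hij s t hs hsK ht htK).1 heq
    · intro heq
      have := (hP i).inj (K i) 0 le_rfl (Nat.zero_le _) (heq.trans (hP0 i).symm)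
      have := hK i
      omega
    · rw [hl]; exact hk₀
    · rw [hl]; exact hk₁
    · exact (hne i j hij _ _ (hK i) le_rfl (hK j) le_rfl).2.2 ⟨rfl, rfl⟩
    · obtain ⟨s, hs, hsK, rfl⟩ := hsupp' i x hx hx0
      obtain ⟨t, ht, htK, rfl⟩ := hsupp' j y hy hy0
      obtain ⟨rfl, rfl⟩ := (hne i j hij s t hs hsK ht htK).2.1 hadj
      exact ⟨rfl, rfl⟩

/-! ### Orienting the two subpaths around the hole. -/

theorem IsHoleMap.getVert_eq (hf : IsHoleMap G n f) {C : G.Subgraph}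
    (hverts : ∀ x, x ∈ C.verts ↔ ∃ i < n, x = f i) {u v : V} {w : G.Walk u v} (hw : w.IsPath)
    (hwC : w.toSubgraph ≤ C) (h0 : u = f 0) (h1 : w.getVert 1 = f 1) {i : ℕ} (hi : i ≤ w.length) :
    i < n ∧ w.getVert i = f i := by
  have h4 := hf.four_le
  induction i using Nat.strong_induction_on with
  | _ i ih =>
    match i, hi, ih with
    | 0, _, _ => exact ⟨by omega, by rw [Walk.getVert_zero, h0]⟩
    | 1, _, _ => exact ⟨by omega, h1⟩
    | i + 2, hi, ih =>
      obtain ⟨hin, hfi⟩ := ih (i + 1) (by omega) (by omega)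
      obtain ⟨-, hfi'⟩ := ih i (by omega) (by omega)
      obtain ⟨j, hj, hfj⟩ := (hverts _).1
        (hwC.1 (w.mem_verts_toSubgraph.2 (w.getVert_mem_support (i + 2))))
      have hadj := w.adj_getVert_succ (i := i + 1) (by omega)
      rw [hfi, hfj, hf.adj _ _ hin hj] at hadj
      have hinj : ∀ t ≤ w.length, w.getVert (i + 2) = w.getVert t → i + 2 = t :=
        fun t ht h => hw.getVert_injOn (by simpa using hi) (by simpa using ht) h
      rcases hadj with rfl | h | h | ⟨rfl, h⟩
      · exact ⟨hj, hfj⟩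
      · obtain rfl : j = i := by omega
        have := hinj j (by omega) (hfj.trans hfi'.symm); omega
      · omega
      · have := hinj 0 (by omega) (by rw [hfj, Walk.getVert_zero, h0]); omega

theorem IsHoleMap.getVert_one (hf : IsHoleMap G n f) {C : G.Subgraph}
    (hverts : ∀ x, x ∈ C.verts ↔ ∃ i < n, x = f i) {u v : V} {w : G.Walk u v}
    (hwC : w.toSubgraph ≤ C) (h0 : u = f 0) (huv : u ≠ v) :
    w.getVert 1 = f 1 ∨ w.getVert 1 = f (n - 1) := by
  have h4 := hf.four_le
  have hlen : 0 < w.length := by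
    by_contra h
    exact huv (w.eq_of_length_eq_zero (by omega))
  obtain ⟨j, hj, hfj⟩ := (hverts _).1
    (hwC.1 (w.mem_verts_toSubgraph.2 (w.getVert_mem_support 1)))
  have hadj := w.adj_getVert_succ hlen
  rw [Walk.getVert_zero, zero_add, hfj] at hadj
  replace hadj := h0 ▸ hadj
  rw [hf.adj _ _ (by omega) hj] at hadj
  rw [hfj]
  rcases (by omega : j = 1 ∨ j = n - 1) with rfl | rfl <;> simp

theorem mem_rotate_iff {C : G.Subgraph}
    (hverts : ∀ x, x ∈ C.verts ↔ ∃ i < n, x = f i) {c : ℕ} (hc : c < n) (x : V) :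
    x ∈ C.verts ↔ ∃ i < n, x = rotate n c f i := by
  rw [hverts]
  constructor
  · rintro ⟨j, hj, rfl⟩
    obtain ⟨i, hi, hij⟩ := exists_unrotate_index hc j hj
    exact ⟨i, hi, (rotate_eq f hj hij).symm⟩
  · rintro ⟨j, hj, rfl⟩
    obtain ⟨i, hi, hij⟩ := exists_rotate_index hc j hj
    exact ⟨i, hi, rotate_eq f hi hij⟩

theorem mem_reflect_iff {C : G.Subgraph}
    (hverts : ∀ x, x ∈ C.verts ↔ ∃ i < n, x = f i) {c : ℕ} (hc : c < n) (x : V) :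
    x ∈ C.verts ↔ ∃ i < n, x = reflect n c f i := by
  rw [hverts]
  constructor
  · rintro ⟨j, hj, rfl⟩
    obtain ⟨i, hi, hij⟩ := exists_reflect_index hc j hj
    exact ⟨i, hi, (reflect_eq f hi hj (by omega)).symm⟩
  · rintro ⟨j, hj, rfl⟩
    obtain ⟨i, hi, hij⟩ := exists_reflect_index hc j hj
    exact ⟨i, hi, reflect_eq f hj hi hij⟩

/-- Two paths of different lengths with the same ends on a hole: there is a cyclic order of the
hole in which the first goes upwards and the second downwards. -/
theorem IsHoleMap.exists_param (hf : IsHoleMap G n f) {C : G.Subgraph}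
    (hverts : ∀ x, x ∈ C.verts ↔ ∃ i < n, x = f i) {u v : V} (hu : u ∈ C.verts) (huv : u ≠ v)
    {L₁ L₂ : G.Walk u v} (h₁ : L₁.IsPath) (h₂ : L₂.IsPath) (h₁C : L₁.toSubgraph ≤ C)
    (h₂C : L₂.toSubgraph ≤ C) (hlen : L₁.length ≠ L₂.length) :
    ∃ f', IsHoleMap G n f' ∧ (∀ x, x ∈ C.verts ↔ ∃ i < n, x = f' i) ∧
      L₁.length + L₂.length = n ∧ (∀ i ≤ L₁.length, L₁.getVert i = f' i) ∧
      (∀ i, 0 < i → i ≤ L₂.length → L₂.getVert i = f' (n - i)) := by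
  have h4 := hf.four_le
  have key : ∀ {f : ℕ → V}, IsHoleMap G n f → (∀ x, x ∈ C.verts ↔ ∃ i < n, x = f i) → u = f 0 →
      L₁.getVert 1 = f 1 → L₁.length + L₂.length = n ∧ (∀ i ≤ L₁.length, L₁.getVert i = f i) ∧
      (∀ i, 0 < i → i ≤ L₂.length → L₂.getVert i = f (n - i)) := by
    intro f hf hverts h0 h1
    have hL₁ := fun i => hf.getVert_eq (i := i) hverts h₁ h₁C h0 h1
    have hend := hL₁ _ le_rfl
    rw [Walk.getVert_length] at hend
    rcases hf.getVert_one hverts h₂C h0 huv with h | h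
    -- Two paths leaving `u` in the same direction and ending at `v` would have equal length.
    · have hend' := hf.getVert_eq hverts h₂ h₂C h0 h le_rfl
      rw [Walk.getVert_length] at hend'
      exact absurd (hf.inj _ _ hend.1 hend'.1 (hend.2.symm.trans hend'.2)) hlen
    · have hr := fun i => (hf.reflect (c := 0) (by omega)).getVert_eq (i := i)
        (mem_reflect_iff hverts (by omega)) h₂ h₂C
        (by rw [reflect_eq (j := 0) f (by omega) (by omega) (by omega), h0])
        (by rw [reflect_eq (j := n - 1) f (by omega) (by omega) (by omega), h])
      have hL₂ : ∀ i, 0 < i → i ≤ L₂.length → L₂.getVert i = f (n - i) := fun i hi hiL => by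
        obtain ⟨hin, heq⟩ := hr i hiL
        rw [heq, reflect_eq (j := n - i) f hin (by omega) (by omega)]
      refine ⟨?_, fun i hi => (hL₁ i hi).2, hL₂⟩
      have hpos : 0 < L₂.length := by
        by_contra h
        exact huv (L₂.eq_of_length_eq_zero (by omega))
      have h' := hL₂ _ hpos le_rfl
      have hlt := (hr _ le_rfl).1
      rw [Walk.getVert_length] at h'
      have := hf.inj _ _ hend.1 (by omega) (hend.2.symm.trans h')
      omega
  obtain ⟨a, ha, hua⟩ := (hverts u).1 hu
  have hf₁ := hf.rotate ha
  have hv₁ := mem_rotate_iff hverts ha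
  have h0 : u = LongHole.rotate n a f 0 := by rw [rotate_eq (j := a) f ha (by omega), hua]
  rcases hf₁.getVert_one hv₁ h₁C h0 huv with h | h
  · exact ⟨_, hf₁, hv₁, key hf₁ hv₁ h0 h⟩
  · have hf₂ := hf₁.reflect (c := 0) (by omega)
    have hv₂ := mem_reflect_iff hv₁ (c := 0) (by omega)
    refine ⟨_, hf₂, hv₂, key hf₂ hv₂ ?_ ?_⟩
    · rw [reflect_eq (j := 0) _ (by omega) (by omega) (by omega), h0]
    · rw [reflect_eq (j := n - 1) _ (by omega) (by omega) (by omega), h]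

end

end LongHole

/-! ### The theorem for subgraphs and walks. -/

theorem theorem3p2 {V : Type*} [Finite V] (G : SimpleGraph V) (ℓ : ℕ) (hℓ : 5 ≤ ℓ)
    (hjewel : ¬ LongHole.HasLongJewel G ℓ (ℓ + 2))
    (hpyramid : ¬ LongHole.HasLongPyramid G ℓ)
    (hhole : ¬ ∃ (H : G.Subgraph) (n : ℕ), LongHole.IsLongOddHole ℓ H n ∧ n ≤ 2 * ℓ + 2)
    (C : G.Subgraph) (hC : LongHole.IsShortestLongOddHole ℓ C) (hclean : LongHole.IsClean C)
    (u v : V) (hu : u ∈ C.verts) (hv : v ∈ C.verts) (huv : u ≠ v) (hnadj : ¬ G.Adj u v)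
    (L₁ L₂ : G.Walk u v) (hL₁ : L₁.IsPath) (hL₂ : L₂.IsPath)
    (hL₁C : L₁.toSubgraph ≤ C) (hL₂C : L₂.toSubgraph ≤ C) (hlt : L₁.length < L₂.length) :
    LongHole.IsShortestPath L₁ ∧
      ∀ P : G.Walk u v, LongHole.IsShortestPath P →
        LongHole.IsShortestLongOddHole ℓ (P.toSubgraph ⊔ L₂.toSubgraph) ∧
          LongHole.IsClean (P.toSubgraph ⊔ L₂.toSubgraph) := by
  obtain ⟨n, ⟨hCn, hℓn, hodd⟩, hmin⟩ := hC
  have S : LongHole.Setting G ℓ n := LongHole.setting_of_forall hℓ hjewel hpyramid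
    (by by_contra h; exact hhole ⟨C, n, ⟨hCn, hℓn, hodd⟩, by omega⟩) (Nat.odd_iff.1 hodd) hmin
  obtain ⟨f₀, hf₀, hverts₀⟩ := hCn.exists_isHoleMap
  obtain ⟨f, hf, hverts, hlen, hget₁, hget₂⟩ :=
    hf₀.exists_param hverts₀ hu huv hL₁ hL₂ hL₁C hL₂C hlt.ne
  have hcl := (hf.isClean_iff hCn.1 hverts).1 hclean
  have hf0 : f 0 = u := by rw [← hget₁ 0 (Nat.zero_le _), SimpleGraph.Walk.getVert_zero]
  have hfd : f L₁.length = v := by rw [← hget₁ _ le_rfl, SimpleGraph.Walk.getVert_length]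
  have h2 : 2 ≤ L₁.length := by
    by_contra h
    rcases (by omega : L₁.length = 0 ∨ L₁.length = 1) with h | h
    · exact huv (L₁.eq_of_length_eq_zero h)
    · exact hnadj (L₁.adj_of_length_eq_one h)
  obtain ⟨d, hd⟩ : ∃ d, d = L₁.length := ⟨_, rfl⟩
  rw [← hd] at hlen hget₁ hfd h2 hlt
  have hshort : ∀ P : G.Walk u v, d ≤ P.length := by
    intro P
    have := (S.distBound_and_rerouting P.length).1 f hf hcl 0 d P.length (by omega) (by omega)
      le_rfl (by rw [hf0, hfd]; exact ⟨P, le_rfl⟩)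
    omega
  refine ⟨⟨hL₁, fun P _ => hd ▸ hshort P⟩, fun P hP => ?_⟩
  have hPd : P.length = d := le_antisymm (hd ▸ hP.2 L₁ hL₁) (hshort P)
  obtain ⟨hg, hgc⟩ := (S.distBound_and_rerouting d).2 f hf hcl d P.getVert h2 le_rfl (by omega)
    (fun i hi => P.adj_getVert_succ (by omega)) (by rw [P.getVert_zero, hf0])
    (by rw [← hPd, P.getVert_length, hPd, hfd])
  have hgP : ∀ i ≤ d, LongHole.splice d f d P.getVert i = P.getVert i :=
    fun i hi => LongHole.splice_of_le hi
  -- Beyond `d` the new hole runs along `L₂` backwards; its end `u` would be index `n`, so it is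
  -- treated separately in `hg0`.
  have hgL : ∀ i < n, d ≤ i → LongHole.splice d f d P.getVert i = L₂.getVert (n - i) := by
    intro i hi hdi
    rw [hget₂ _ (by omega) (by omega), show n - (n - i) = i by omega]
    rcases hdi.eq_or_lt with rfl | h
    · rw [hgP _ le_rfl, ← hPd, P.getVert_length, hPd, hfd]
    · exact LongHole.splice_of_lt h rfl
  have hg0 : LongHole.splice d f d P.getVert 0 = L₂.getVert 0 := by
    rw [hgP 0 (by omega), P.getVert_zero, L₂.getVert_zero]
  have hsucc : ∀ i, i + 1 < n → (P.toSubgraph ⊔ L₂.toSubgraph).Adj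
      (LongHole.splice d f d P.getVert i) (LongHole.splice d f d P.getVert (i + 1)) := by
    intro i hi
    rw [SimpleGraph.Subgraph.sup_adj]
    by_cases hid : i < d
    · rw [hgP i hid.le, hgP (i + 1) hid]
      exact .inl (P.toSubgraph_adj_getVert (by omega))
    · rw [hgL i (by omega) (by omega), hgL (i + 1) hi (by omega)]
      have := L₂.toSubgraph_adj_getVert (i := n - (i + 1)) (by omega)
      rw [show n - (i + 1) + 1 = n - i by omega] at this
      exact .inr this.symm
  have hlast : (P.toSubgraph ⊔ L₂.toSubgraph).Adj
      (LongHole.splice d f d P.getVert 0) (LongHole.splice d f d P.getVert (n - 1)) := by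
    rw [SimpleGraph.Subgraph.sup_adj, hg0, hgL (n - 1) (by omega) (by omega),
      show n - (n - 1) = 0 + 1 by omega]
    exact .inr (L₂.toSubgraph_adj_getVert (by omega))
  have hmem : ∀ x, x ∈ (P.toSubgraph ⊔ L₂.toSubgraph).verts ↔
      ∃ i < n, x = LongHole.splice d f d P.getVert i := by
    intro x
    rw [SimpleGraph.Subgraph.verts_sup, Set.mem_union, SimpleGraph.Walk.mem_verts_toSubgraph,
      SimpleGraph.Walk.mem_verts_toSubgraph, SimpleGraph.Walk.mem_support_iff_exists_getVert,
      SimpleGraph.Walk.mem_support_iff_exists_getVert]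
    constructor
    · rintro (⟨i, rfl, hi⟩ | ⟨i, rfl, hi⟩)
      · exact ⟨i, by omega, (hgP i (by omega)).symm⟩
      · rcases Nat.eq_zero_or_pos i with rfl | h
        · exact ⟨0, by omega, hg0.symm⟩
        · refine ⟨n - i, by omega, ?_⟩
          rw [hgL _ (by omega) (by omega), show n - (n - i) = i by omega]
    · rintro ⟨i, hi, rfl⟩
      by_cases hid : i ≤ d
      · exact .inl ⟨i, (hgP i hid).symm, by omega⟩
      · exact .inr ⟨n - i, (hgL i hi (by omega)).symm, by omega⟩
  have hind : (P.toSubgraph ⊔ L₂.toSubgraph).IsInduced := by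
    intro x hx y hy hadj
    obtain ⟨i, hi, rfl⟩ := (hmem x).1 hx
    obtain ⟨j, hj, rfl⟩ := (hmem y).1 hy
    rcases (hg.adj i j hi hj).1 hadj with rfl | rfl | ⟨rfl, h⟩ | ⟨rfl, h⟩
    · exact hsucc i hj
    · exact (hsucc j hi).symm
    · obtain rfl : j = n - 1 := by omega
      exact hlast
    · obtain rfl : i = n - 1 := by omega
      exact hlast.symm
  exact ⟨⟨n, ⟨hg.isHole hind hmem, hℓn, hodd⟩, hmin⟩, (hg.isClean_iff hind hmem).2 hgc⟩
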